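/- Let $\mathbb T=(-\pi,\pi)^3$ be the 3D torus, let $\gamma>0$ and $g\in[L^2(\mathbb T)]^3$ be fixed. Let $\mathcal H_0=\{v\in[L^2(\mathbb T)]^3:\operatorname{div}v=0\}$ and, for $\alpha>0$, let $\mathcal H_\alpha=\{v\in[H^1(\mathbb T)]^3:\operatorname{div}v=0\}$ with the norm $\|v\|_{\mathcal H_\alpha}^2=\|v\|_{L^2}^2+\alpha\|\nabla v\|_{L^2}^2$. For $\alpha>0$ consider the damped Euler--Bardina system $$\partial_t\bar u-\alpha\partial_t\Delta\bar u+(\bar u,\nabla)\bar u+\nabla p+\gamma(\bar u-\alpha\Delta\bar u)=g,\qquad \operatorname{div}\bar u=0,\qquad(\ast)_\alpha$$ whose solutions are understood in the class $\bar u\in C^1([0,\infty),\mathcal H_\alpha)$. For a function $\tilde u:[0,\infty)\to\mathcal H_0$, call $(\bar u_{\alpha_n})_{n\in\mathbb N}$ an approximation of $\tilde u$ if $\alpha_n>0$, $\alpha_n\to0$, each $\bar u_{\alpha_n}$ is a solution of $(\ast)_{\alpha_n}$, the norms $\|\bar u_{\alpha_n}(0)\|_{\mathcal H_{\alpha_n}}$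 are bounded uniformly in $n$, and $\bar u_{\alpha_n}(t)\rightharpoonup\tilde u(t)$ weakly in $\mathcal H_0$ for every $t\ge0$. Let $\mathcal K_0^+$ be the set of all $\tilde u$ that have an approximation, and for $\tilde u\in\mathcal K_0^+$ and $t\ge 0$ put $$M_{\tilde u,0}(t)=\inf\ \liminf_{n\to\infty}\|\bar u_{\alpha_n}(t)\|_{\mathcal H_{\alpha_n}}^2,$$ the infimum being over all approximations $(\bar u_{\alpha_n})$ of $\tilde u$. Let $\tilde u^l\in\mathcal K_0^+$, $l\in\mathbb N$, be such that the sequence $M_{\tilde u^l,0}(0)$ is bounded, and let $\tilde u^l\rightharpoonup\tilde u$ weakly star in $L^\infty_{loc}(\mathbb R_+,\mathcal H_0)$, where $\mathbb R_+=[0,\infty)$. Then $\tilde u\in\mathcal K_0^+$ (that is, $\tilde u$ coincides almost everywhere with a unique element of $\mathcal K_0^+$, again denoted by $\tilde u$), and $$M_{\tilde u,0}(t)\le\liminf_{l\to\infty}M_{\tilde u^l,0}(t)\qquad\text{for all }t\ge0.$$ In particular, if $M_{\tilde u^l,0}(0)\le C$ for all $l$, then $M_{\tilde u,0}(0)\le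 C$: the sets $\{\tilde u\in\mathcal K_0^+:M_{\tilde u,0}(0)\le C\}$ are sequentially closed under weak-star limits. -/

import Mathlib

open MeasureTheory Filter Topology Set
open scoped ENNReal NNReal ContDiff

namespace BardinaEuler

noncomputable section

/-- The period `2π` is positive (needed for the Lebesgue measure on `AddCircle (2π)`). -/
instance factTwoPiPos : Fact (0 < 2 * Real.pi) := ⟨Real.two_pi_pos⟩

/-- The torus `(-π, π)³` with opposite faces identified; its `volume` is Lebesgue measure. -/
abbrev Torus : Type := Fin 3 → AddCircle (2 * Real.pi)

/-- The covering map `ℝ³ → 𝕋`. -/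
def cover (y : Fin 3 → ℝ) : Torus := fun i => (y i : AddCircle (2 * Real.pi))

/-- Square integrable vector fields `[L²(𝕋)]³`. -/
abbrev L2Vec : Type := Lp (EuclideanSpace ℝ (Fin 3)) 2 (volume : Measure Torus)

/-- Square integrable `3 × 3` matrix fields, with the Frobenius norm of matrices. -/
abbrev L2Mat : Type := Lp (EuclideanSpace ℝ (Fin 3 × Fin 3)) 2 (volume : Measure Torus)

/-- `φ ∈ C^∞(𝕋)`: the `2π`-periodic lift of `φ` to `ℝ³` is smooth. -/
def IsSmooth (φ : Torus → ℝ) : Prop := ContDiff ℝ ∞ (fun y : Fin 3 → ℝ => φ (cover y))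

/-- The classical partial derivative `∂_j φ` of a function on the torus. -/
def pderiv (j : Fin 3) (φ : Torus → ℝ) (x : Torus) : ℝ :=
  deriv (fun s : ℝ => φ (x + cover (Pi.single j s))) 0

/-- `div u = 0` in the sense of distributions on the torus. -/
def IsDivFree (u : L2Vec) : Prop :=
  ∀ φ : Torus → ℝ, IsSmooth φ → ∫ x, ∑ i, u x i * pderiv i φ x = 0

/-- `G i j = ∂_j u_i` in the sense of distributions on the torus. -/
def IsWeakGrad (u : L2Vec) (G : L2Mat) : Prop :=
  ∀ φ : Torus → ℝ, IsSmooth φ → ∀ i j : Fin 3,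
    ∫ x, u x i * pderiv j φ x = - ∫ x, G x (i, j) * φ x

/-! Integrability of the integrands above, used for the linearity of the two conditions. -/

lemma cover_add (y z : Fin 3 → ℝ) : cover (y + z) = cover y + cover z := by
  funext i; simp [cover]

lemma isOpenQuotientMap_cover : IsOpenQuotientMap cover :=
  IsOpenQuotientMap.piMap (fun _ => QuotientAddGroup.isOpenQuotientMap_mk)

lemma IsSmooth.continuous {φ : Torus → ℝ} (h : IsSmooth φ) : Continuous φ :=
  isOpenQuotientMap_cover.isQuotientMap.continuous_iff.2 (ContDiff.continuous h)

lemma pderiv_cover {φ : Torus → ℝ} (h : IsSmooth φ) (j : Fin 3) (y : Fin 3 → ℝ) :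
    pderiv j φ (cover y) = fderiv ℝ (fun y => φ (cover y)) y (Pi.single j 1) := by
  have hd : DifferentiableAt ℝ (fun y : Fin 3 → ℝ => φ (cover y)) y :=
    (ContDiff.differentiable h (by simp)) y
  rw [← hd.lineDeriv_eq_fderiv]
  unfold pderiv lineDeriv
  congr 1
  funext s
  rw [← cover_add]
  congr 3
  rw [← Pi.single_smul, smul_eq_mul, mul_one]

lemma IsSmooth.continuous_pderiv {φ : Torus → ℝ} (h : IsSmooth φ) (j : Fin 3) :
    Continuous (pderiv j φ) := by
  refine isOpenQuotientMap_cover.isQuotientMap.continuous_iff.2 ?_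
  have : pderiv j φ ∘ cover =
      fun y => fderiv ℝ (fun y => φ (cover y)) y (Pi.single j 1) := by
    funext y; exact pderiv_cover h j y
  rw [this]
  exact (ContDiff.continuous_fderiv h (by simp)).clm_apply continuous_const

lemma integrable_mul {ι : Type} [Fintype ι] (u : Lp (EuclideanSpace ℝ ι) 2 (volume : Measure Torus))
    (i : ι) {ψ : Torus → ℝ} (hψ : Continuous ψ) : Integrable (fun x => u x i * ψ x) := by
  have hu : Integrable (fun x => u x) (volume : Measure Torus) :=
    (Lp.memLp u).integrable (by norm_num)
  have hi : Integrable (fun x => u x i) (volume : Measure Torus) :=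
    (EuclideanSpace.proj (𝕜 := ℝ) i).integrable_comp hu
  obtain ⟨C, hC⟩ := isCompact_univ.exists_bound_of_continuousOn hψ.continuousOn
  exact hi.mul_bdd (c := C) hψ.aestronglyMeasurable (ae_of_all _ fun x => hC x (mem_univ x))

lemma coord_add {ι : Type} [Fintype ι] (u v : Lp (EuclideanSpace ℝ ι) 2 (volume : Measure Torus)) :
    ∀ᵐ x, ∀ i, (u + v) x i = u x i + v x i := by
  filter_upwards [Lp.coeFn_add u v] with x hx i
  rw [hx]; rfl

lemma coord_smul {ι : Type} [Fintype ι] (c : ℝ)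
    (u : Lp (EuclideanSpace ℝ ι) 2 (volume : Measure Torus)) :
    ∀ᵐ x, ∀ i, (c • u) x i = c * u x i := by
  filter_upwards [Lp.coeFn_smul c u] with x hx i
  rw [hx]; rfl

lemma coord_zero (ι : Type) [Fintype ι] :
    ∀ᵐ x, ∀ i, (0 : Lp (EuclideanSpace ℝ ι) 2 (volume : Measure Torus)) x i = 0 := by
  filter_upwards [Lp.coeFn_zero (EuclideanSpace ℝ ι) 2 (volume : Measure Torus)] with x hx i
  rw [hx]; rfl

/-- The space `𝓗₀` of divergence free fields in `[L²(𝕋)]³`, with the `L²` inner product. -/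
def H0 : Submodule ℝ L2Vec where
  carrier := {u | IsDivFree u}
  zero_mem' := by
    intro φ _
    rw [integral_eq_zero_of_ae]
    filter_upwards [coord_zero (Fin 3)] with x hx
    simp only [hx, zero_mul, Finset.sum_const_zero, Pi.zero_apply]
  add_mem' := by
    intro u v hu hv φ hφ
    have hI : ∀ w : L2Vec, Integrable (fun x => ∑ i, w x i * pderiv i φ x) := fun w =>
      integrable_finsetSum _ fun i _ => integrable_mul w i (hφ.continuous_pderiv i)
    have h := integral_add (hI u) (hI v)
    rw [hu φ hφ, hv φ hφ, add_zero] at h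
    rw [← h]
    refine integral_congr_ae ?_
    filter_upwards [coord_add u v] with x hx
    simp only [hx, add_mul, Finset.sum_add_distrib]
  smul_mem' := by
    intro c u hu φ hφ
    have h := integral_const_mul (μ := (volume : Measure Torus)) c
      (fun x => ∑ i, u x i * pderiv i φ x)
    rw [hu φ hφ, mul_zero] at h
    rw [← h]
    refine integral_congr_ae ?_
    filter_upwards [coord_smul c u] with x hx
    simp only [hx, mul_assoc, Finset.mul_sum]

/-- The divergence free fields in `[H¹(𝕋)]³`, each represented by the pair `(u, ∇u)` with `∇u` its
weak gradient (which is unique). The norm `(‖u‖² + ‖∇u‖²)^(1/2)` of this space is the `H¹` norm. For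
`α > 0` it is the space underlying `𝓗_α`, and the norm of `𝓗_α` is equivalent to it. -/
def V : Submodule ℝ (WithLp 2 (L2Vec × L2Mat)) where
  carrier := {p | p.fst ∈ H0 ∧ IsWeakGrad p.fst p.snd}
  zero_mem' := by
    refine ⟨H0.zero_mem, fun φ _ i j => ?_⟩
    rw [integral_eq_zero_of_ae, integral_eq_zero_of_ae, neg_zero]
    · filter_upwards [coord_zero (Fin 3 × Fin 3)] with x hx
      simp only [WithLp.zero_snd, hx, zero_mul, Pi.zero_apply]
    · filter_upwards [coord_zero (Fin 3)] with x hx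
      simp only [WithLp.zero_fst, hx, zero_mul, Pi.zero_apply]
  add_mem' := by
    rintro p q ⟨hp, hp'⟩ ⟨hq, hq'⟩
    refine ⟨H0.add_mem hp hq, fun φ hφ i j => ?_⟩
    have h1 := integral_add (integrable_mul p.fst i (hφ.continuous_pderiv j))
      (integrable_mul q.fst i (hφ.continuous_pderiv j))
    have h2 := integral_add (integrable_mul p.snd (i, j) hφ.continuous)
      (integrable_mul q.snd (i, j) hφ.continuous)
    rw [hp' φ hφ i j, hq' φ hφ i j, ← neg_add, ← h2] at h1
    refine Eq.trans ?_ (h1.trans ?_)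
    · refine integral_congr_ae ?_
      filter_upwards [coord_add p.fst q.fst] with x hx
      simp only [WithLp.add_fst, hx, add_mul]
    · congr 1
      refine integral_congr_ae ?_
      filter_upwards [coord_add p.snd q.snd] with x hx
      simp only [WithLp.add_snd, hx, add_mul]
  smul_mem' := by
    rintro c p ⟨hp, hp'⟩
    refine ⟨H0.smul_mem c hp, fun φ hφ i j => ?_⟩
    have h1 := integral_const_mul (μ := (volume : Measure Torus)) c
      (fun x => p.fst x i * pderiv j φ x)
    have h2 := integral_const_mul (μ := (volume : Measure Torus)) c
      (fun x => p.snd x (i, j) * φ x)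
    rw [hp' φ hφ i j, mul_neg, ← h2] at h1
    refine Eq.trans ?_ (h1.trans ?_)
    · refine integral_congr_ae ?_
      filter_upwards [coord_smul c p.fst] with x hx
      simp only [WithLp.smul_fst, hx, mul_assoc]
    · congr 1
      refine integral_congr_ae ?_
      filter_upwards [coord_smul c p.snd] with x hx
      simp only [WithLp.smul_snd, hx, mul_assoc]

/-- The velocity field itself, as an element of `𝓗₀` (the embedding `𝓗_α ⊂ 𝓗₀`). -/
def vel (v : V) : H0 := ⟨v.1.fst, v.2.1⟩

/-- The gradient of the velocity field. -/
def grad (v : V) : L2Mat := v.1.snd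

/-- The inner product `(v, w) + α (∇v, ∇w)` of `𝓗_α`. -/
def innerH (α : ℝ) (v w : V) : ℝ := inner ℝ (vel v) (vel w) + α * inner ℝ (grad v) (grad w)

/-- The squared norm `‖v‖²_{L²} + α ‖∇v‖²_{L²}` of `𝓗_α`. -/
def normSqH (α : ℝ) (v : V) : ℝ := ‖vel v‖ ^ 2 + α * ‖grad v‖ ^ 2

/-- The inertial term `((u, ∇) v, w) = ∫ ∑ u_j ∂_j v_i w_i`. -/
def inertial (u v w : V) : ℝ :=
  ∫ x, ∑ i, ∑ j, (vel u : L2Vec) x j * grad v x (i, j) * (vel w : L2Vec) x i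

/-- `u ∈ C¹([0,∞), 𝓗_α)` is a global solution of the damped Euler–Bardina system
`∂ₜu - α ∂ₜΔu + (u,∇)u + ∇p + γ(u - αΔu) = g`, `div u = 0`. The pressure is eliminated, as usual, by
testing with divergence free `H¹` fields `w`; the terms with `Δ` are integrated by parts. -/
structure IsSolution (γ : ℝ) (g : L2Vec) (α : ℝ) (u : ℝ → V) : Prop where
  contDiffOn : ContDiffOn ℝ 1 u (Ici 0)
  equation : ∀ t : ℝ, 0 ≤ t → ∀ w : V,
    innerH α (derivWithin u (Ici 0) t) w + inertial (u t) (u t) w + γ * innerH α (u t) w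
      = inner ℝ g (vel w : L2Vec)

/-- The solutions `u n` of the damped Euler–Bardina systems with parameters `α n > 0`, `α n → 0`, have
initial data uniformly bounded in `𝓗_{α n}` and satisfy `u n t ⇀ v t` weakly in `𝓗₀` for every
`t ≥ 0`. -/
structure Approximates (γ : ℝ) (g : L2Vec) (v : ℝ → H0) (α : ℕ → ℝ) (u : ℕ → ℝ → V) : Prop where
  pos : ∀ n, 0 < α n
  tendsto_zero : Tendsto α atTop (𝓝 0)
  solution : ∀ n, IsSolution γ g (α n) (u n)
  bounded : ∃ C : ℝ, ∀ n, normSqH (α n) (u n 0) ≤ C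
  weak : ∀ t : ℝ, 0 ≤ t → ∀ w : H0,
    Tendsto (fun n => inner ℝ (vel (u n t)) w) atTop (𝓝 (inner ℝ (v t) w))

/-- The trajectory phase space `𝓚₀⁺` of the limit damped Euler equation. Trajectories are functions on
`[0,∞)`; the values at negative times are irrelevant. -/
def K (γ : ℝ) (g : L2Vec) : Set (ℝ → H0) := {v | ∃ α u, Approximates γ g v α u}

/-- The `M`-functional `M_{v,φ}(t)`, with values in `[0,∞]`: the infimum of
`liminf ‖u_n(t) - φ(t)‖²_{𝓗_{α_n}}` over all approximations of `v` (no truncation occurs in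
`ENNReal.ofReal`, since the parameters `α_n` are positive). -/
def M (γ : ℝ) (g : L2Vec) (v : ℝ → H0) (φ : ℝ → V) (t : ℝ) : ℝ≥0∞ :=
  ⨅ (α : ℕ → ℝ) (u : ℕ → ℝ → V) (_ : Approximates γ g v α u),
    liminf (fun n => ENNReal.ofReal (normSqH (α n) (u n t - φ t))) atTop

/-- Membership in `L^∞_loc(ℝ₊, 𝓗₀)`. -/
def MemLinftyLoc (v : ℝ → H0) : Prop := ∀ T : ℝ, MemLp v ∞ (volume.restrict (Icc 0 T))

/-- Weak star convergence in `L^∞_loc(ℝ₊, 𝓗₀)`: for every `T`, convergence against all functions in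
`L¹([0,T], 𝓗₀)`. -/
def TendstoWeakStar (v : ℕ → ℝ → H0) (v' : ℝ → H0) : Prop :=
  ∀ (T : ℝ) (ψ : ℝ → H0), Integrable ψ (volume.restrict (Icc 0 T)) →
    Tendsto (fun l => ∫ t in Icc 0 T, inner ℝ (v l t) (ψ t)) atTop
      (𝓝 (∫ t in Icc 0 T, inner ℝ (v' t) (ψ t)))

end

end BardinaEuler

namespace BardinaEuler

noncomputable section

/-! ### Continuous fields as square integrable fields -/

section ContinuousFields

variable {ι : Type} [Fintype ι]

/-! The inertial term does no work on the solution itself (`inertial_self`), so the integrating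
factor `exp (2γt)` turns the energy equation into an exact balance (`IsSolution.energy_eq`): `exp
(2γt) E(t) - E(0)` equals a linear functional `F_t` of the velocity alone. This functional passes to
the limit along every approximation of a trajectory `v` (`Approximates.tendsto_energy`). The energy
gap between the times `0` and `t` is therefore dictated by `v`, not by the approximation, and an
approximation that is nearly optimal at time `0` is nearly optimal at every time.

For each `l`, choose an approximation of the `l`-th trajectory whose initial energies are at most
`M(0) + 1/(l+1)`, and extract one diagonal sequence. If it approximates the weak-star limit,
semicontinuity follows for all `t` at once: its energy at `t` is controlled by its initial energy
and `F_t`, the former by `M(0)` of the `l`-th trajectory, and this in turn by `M(t)` (`M_zero_le`);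
the contributions of `F_t` cancel in the limit by weak-star convergence.

Compactness comes from equicontinuity in time (`exists_lipschitz`). Against a smooth field `w` the
inertial term is bounded by the kinetic energy, because the derivative can be moved onto `w`
(`exists_inertial_le`), and the gradient part of the `𝓗_α` product is only `O(√α)`. Trajectories are
thus uniformly Lipschitz against smooth fields. This upgrades weak-star convergence to weak
convergence at every time (`exists_pointwise_limit`), lets the diagonal choice be made on countably
many times and test fields (`exists_diagonal`), and makes the representative unique
(`eqOn_of_ae_eq`). The density of smooth fields that all this requires is proved with Fourier modes.
-/

lemma memLp_of_continuous {f : ι → Torus → ℝ} (hf : ∀ i, Continuous (f i)) :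
    MemLp (fun x => (WithLp.toLp 2 (fun i => f i x) : EuclideanSpace ℝ ι)) 2
      (volume : Measure Torus) := by
  have hc : Continuous (fun x => (WithLp.toLp 2 (fun i => f i x) : EuclideanSpace ℝ ι)) := by
    fun_prop
  obtain ⟨C, hC⟩ := isCompact_univ.exists_bound_of_continuousOn hc.continuousOn
  exact MemLp.of_bound hc.aestronglyMeasurable C (ae_of_all _ fun x => hC x (mem_univ x))

/-- The square integrable field with continuous components `f i`. -/
def ofCont (f : ι → Torus → ℝ) (hf : ∀ i, Continuous (f i)) :
    Lp (EuclideanSpace ℝ ι) 2 (volume : Measure Torus) :=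
  (memLp_of_continuous hf).toLp _

lemma ofCont_ae {f : ι → Torus → ℝ} (hf : ∀ i, Continuous (f i)) :
    ∀ᵐ x, ∀ i, ofCont f hf x i = f i x := by
  filter_upwards [(memLp_of_continuous hf).coeFn_toLp] with x hx i
  rw [ofCont, hx]

lemma inner_eq_integral (u v : Lp (EuclideanSpace ℝ ι) 2 (volume : Measure Torus)) :
    inner ℝ u v = ∫ x, ∑ i, u x i * v x i := by
  rw [L2.inner_def]
  refine integral_congr_ae (ae_of_all _ fun x => ?_)
  simp [PiLp.inner_apply, mul_comm]

lemma inner_ofCont (u : Lp (EuclideanSpace ℝ ι) 2 (volume : Measure Torus))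
    {f : ι → Torus → ℝ} (hf : ∀ i, Continuous (f i)) :
    inner ℝ u (ofCont f hf) = ∫ x, ∑ i, u x i * f i x := by
  rw [inner_eq_integral]
  refine integral_congr_ae ?_
  filter_upwards [ofCont_ae hf] with x hx
  simp only [hx]

lemma inner_ofCont_sum (u : Lp (EuclideanSpace ℝ ι) 2 (volume : Measure Torus))
    {f : ι → Torus → ℝ} (hf : ∀ i, Continuous (f i)) :
    inner ℝ u (ofCont f hf) = ∑ i, ∫ x, u x i * f i x := by
  rw [inner_ofCont, integral_finsetSum _ fun i _ => integrable_mul u i (hf i)]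

/-- The integral is an inner product with the field whose only nonzero component is `ψ`, in position
`i`. -/
lemma continuous_integral_mul (i : ι) {ψ : Torus → ℝ} (hψ : Continuous ψ) :
    Continuous (fun u : Lp (EuclideanSpace ℝ ι) 2 (volume : Measure Torus) =>
      ∫ x, u x i * ψ x) := by
  classical
  have hf : ∀ j, Continuous ((Pi.single i ψ : ι → Torus → ℝ) j) := by
    intro j
    by_cases h : j = i
    · subst h; simpa using hψ
    · simpa [Pi.single_eq_of_ne h] using (continuous_zero : Continuous (0 : Torus → ℝ))
  have : (fun u : Lp (EuclideanSpace ℝ ι) 2 (volume : Measure Torus) => ∫ x, u x i * ψ x)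
      = fun u => inner ℝ u (ofCont _ hf) := by
    funext u
    rw [inner_ofCont_sum, Finset.sum_eq_single i]
    · simp
    · intro j _ h
      simp [Pi.single_eq_of_ne h]
    · simp
  rw [this]
  fun_prop

end ContinuousFields

/-! ### Completeness of the solenoidal spaces. -/

lemma isClosed_H0 : IsClosed (H0 : Set L2Vec) := by
  have : (H0 : Set L2Vec) = ⋂ (φ : Torus → ℝ) (_ : IsSmooth φ),
      {u : L2Vec | ∑ i, ∫ x, u x i * pderiv i φ x = 0} := by
    ext u
    simp only [mem_iInter, mem_ofPred_eq]
    refine forall₂_congr fun φ hφ => ?_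
    rw [integral_finsetSum _ fun i _ => integrable_mul u i (hφ.continuous_pderiv i)]
  rw [this]
  refine isClosed_iInter fun φ => isClosed_iInter fun hφ => ?_
  exact isClosed_eq (continuous_finsetSum _ fun i _ =>
    continuous_integral_mul i (hφ.continuous_pderiv i)) continuous_const

instance completeSpace_H0 : CompleteSpace H0 := isClosed_H0.completeSpace_coe

lemma isClosed_V : IsClosed (V : Set (WithLp 2 (L2Vec × L2Mat))) := by
  have hfst : Continuous fun p : WithLp 2 (L2Vec × L2Mat) => p.fst :=
    (WithLp.fstL 2 ℝ L2Vec L2Mat).continuous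
  have hsnd : Continuous fun p : WithLp 2 (L2Vec × L2Mat) => p.snd :=
    (WithLp.sndL 2 ℝ L2Vec L2Mat).continuous
  have : (V : Set (WithLp 2 (L2Vec × L2Mat))) = {p | p.fst ∈ H0} ∩
      ⋂ (φ : Torus → ℝ) (_ : IsSmooth φ) (i : Fin 3) (j : Fin 3),
      {p | ∫ x, p.fst x i * pderiv j φ x = - ∫ x, p.snd x (i, j) * φ x} := by
    ext p
    simp only [mem_inter_iff, mem_iInter, mem_ofPred_eq]
    exact Iff.rfl
  rw [this]
  refine (isClosed_H0.preimage hfst).inter ?_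
  refine isClosed_iInter fun φ => isClosed_iInter fun hφ => isClosed_iInter fun i =>
    isClosed_iInter fun j => ?_
  exact isClosed_eq ((continuous_integral_mul i (hφ.continuous_pderiv j)).comp hfst)
    ((continuous_integral_mul (i, j) hφ.continuous).comp hsnd).neg

instance completeSpace_V : CompleteSpace V := isClosed_V.completeSpace_coe

/-- The embedding of `V` into `𝓗₀` as a continuous linear map. -/
def velL : V →L[ℝ] H0 :=
  ((WithLp.fstL 2 ℝ L2Vec L2Mat).comp V.subtypeL).codRestrict H0 fun v => v.2.1

/-- The gradient as a continuous linear map on `V`. -/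
def gradL : V →L[ℝ] L2Mat := (WithLp.sndL 2 ℝ L2Vec L2Mat).comp V.subtypeL

/-! ### Trigonometric modes -/

/-- The character `x ↦ exp (i k·x)` of the torus. -/
def character (k : Fin 3 → ℤ) : C(Torus, ℂ) where
  toFun x := ∏ i, fourier (k i) (x i)
  continuous_toFun := by fun_prop

lemma character_cover (k : Fin 3 → ℤ) (y : Fin 3 → ℝ) :
    character k (cover y) = Complex.exp ((∑ i, k i * y i : ℝ) * Complex.I) := by
  have h2 : (Real.pi : ℂ) ≠ 0 := by exact_mod_cast Real.pi_ne_zero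
  simp only [character, ContinuousMap.coe_mk, cover, fourier_coe_apply]
  rw [← Complex.exp_sum]
  congr 1
  push_cast
  rw [Finset.sum_mul]
  refine Finset.sum_congr rfl fun i _ => ?_
  field_simp

/-- The rescaling of the unit torus onto `Torus`. -/
def rescale : UnitAddTorus (Fin 3) ≃ₜ Torus :=
  Homeomorph.piCongrRight fun _ =>
    AddCircle.homeomorphAddCircle (1 : ℝ) (2 * Real.pi) one_ne_zero Real.two_pi_pos.ne'

lemma character_rescale (k : Fin 3 → ℤ) (x : UnitAddTorus (Fin 3)) :
    character k (rescale x) = UnitAddTorus.mFourier k x := by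
  simp only [character, UnitAddTorus.mFourier, ContinuousMap.coe_mk]
  refine Finset.prod_congr rfl fun i _ => ?_
  have h2 : (Real.pi : ℂ) ≠ 0 := by exact_mod_cast Real.pi_ne_zero
  have : rescale x i = AddCircle.homeomorphAddCircle (1 : ℝ) (2 * Real.pi) one_ne_zero
    Real.two_pi_pos.ne' (x i) := rfl
  rw [this]
  induction x i using QuotientAddGroup.induction_on with
  | H z =>
    have h := AddCircle.homeomorphAddCircle_apply_mk (1 : ℝ) (2 * Real.pi) one_ne_zero
      Real.two_pi_pos.ne' z
    erw [h]
    erw [fourier_coe_apply, fourier_coe_apply]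
    congr 1
    push_cast
    field_simp

/-- Precomposition with the inverse of `rescale`. -/
def precompRescale : C(UnitAddTorus (Fin 3), ℂ) →L[ℂ] C(Torus, ℂ) where
  toFun f := f.comp ⟨rescale.symm, rescale.symm.continuous⟩
  map_add' _ _ := rfl
  map_smul' _ _ := rfl
  cont := ContinuousMap.continuous_precomp _

/-- Density of the Fourier monomials on the unit torus is transported through the homeomorphism
`rescale`; a surjective continuous linear map carries dense subspaces to dense subspaces. -/
lemma span_character_closure_eq_top :
    (Submodule.span ℂ (range character)).topologicalClosure = ⊤ := by
  have hs : Function.Surjective precompRescale := by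
    intro f
    refine ⟨f.comp ⟨rescale, rescale.continuous⟩, ?_⟩
    ext x
    simp [precompRescale]
  have h := hs.denseRange.topologicalClosure_map_submodule
    (UnitAddTorus.span_mFourier_closure_eq_top (d := Fin 3))
  rw [Submodule.map_span, ← range_comp] at h
  have he : (⇑(precompRescale : C(UnitAddTorus (Fin 3), ℂ) →ₗ[ℂ] C(Torus, ℂ)) ∘
      UnitAddTorus.mFourier) = character := by
    funext k
    ext x
    simp [precompRescale, ← character_rescale]
  erw [he] at h
  exact h

/-- `x ↦ cos (k·x)`. -/
def cosMode (k : Fin 3 → ℤ) (x : Torus) : ℝ := (character k x).re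

/-- `x ↦ sin (k·x)`. -/
def sinMode (k : Fin 3 → ℤ) (x : Torus) : ℝ := (character k x).im

lemma cosMode_cover (k : Fin 3 → ℤ) (y : Fin 3 → ℝ) :
    cosMode k (cover y) = Real.cos (∑ i, k i * y i) := by
  rw [cosMode, character_cover, Complex.exp_ofReal_mul_I_re]

lemma sinMode_cover (k : Fin 3 → ℤ) (y : Fin 3 → ℝ) :
    sinMode k (cover y) = Real.sin (∑ i, k i * y i) := by
  rw [sinMode, character_cover, Complex.exp_ofReal_mul_I_im]

lemma isSmooth_cosMode (k : Fin 3 → ℤ) : IsSmooth (cosMode k) := by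
  simp only [IsSmooth, cosMode_cover]
  fun_prop

lemma isSmooth_sinMode (k : Fin 3 → ℤ) : IsSmooth (sinMode k) := by
  simp only [IsSmooth, sinMode_cover]
  fun_prop

lemma surjective_cover : Function.Surjective cover := isOpenQuotientMap_cover.surjective

lemma hasDerivAt_phase (k : Fin 3 → ℤ) (j : Fin 3) (y : Fin 3 → ℝ) :
    HasDerivAt (fun s : ℝ => ∑ i, (k i : ℝ) * (y + (Pi.single j s : Fin 3 → ℝ)) i) (k j) 0 := by
  have : (fun s : ℝ => ∑ i, (k i : ℝ) * (y + (Pi.single j s : Fin 3 → ℝ)) i)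
      = fun s => (∑ i, (k i : ℝ) * y i) + k j * s := by
    funext s
    simp [mul_add, Finset.sum_add_distrib, Pi.single_apply]
  rw [this]
  simpa using ((hasDerivAt_id (0 : ℝ)).const_mul (k j : ℝ)).const_add (∑ i, (k i : ℝ) * y i)

lemma pderiv_cosMode (k : Fin 3 → ℤ) (j : Fin 3) (x : Torus) :
    pderiv j (cosMode k) x = -(k j * sinMode k x) := by
  obtain ⟨y, rfl⟩ := surjective_cover x
  simp only [pderiv, ← cover_add, cosMode_cover, sinMode_cover]
  refine ((hasDerivAt_phase k j y).cos.congr_deriv ?_).deriv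
  simp [mul_comm]

lemma pderiv_sinMode (k : Fin 3 → ℤ) (j : Fin 3) (x : Torus) :
    pderiv j (sinMode k) x = k j * cosMode k x := by
  obtain ⟨y, rfl⟩ := surjective_cover x
  simp only [pderiv, ← cover_add, cosMode_cover, sinMode_cover]
  refine ((hasDerivAt_phase k j y).sin.congr_deriv ?_).deriv
  simp [mul_comm]

/-- A square integrable function orthogonal to all trigonometric modes vanishes. -/
lemma ae_eq_zero_of_modes {f : Torus → ℝ} (hf : MemLp f 2 (volume : Measure Torus))
    (hc : ∀ k, ∫ x, f x * cosMode k x = 0) (hs : ∀ k, ∫ x, f x * sinMode k x = 0) :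
    f =ᵐ[volume] 0 := by
  have hfi : ∀ {ψ : Torus → ℝ}, Continuous ψ → Integrable (fun x => f x * ψ x) := by
    intro ψ hψ
    obtain ⟨C, hC⟩ := isCompact_univ.exists_bound_of_continuousOn hψ.continuousOn
    exact (hf.integrable (by norm_num)).mul_bdd (c := C) hψ.aestronglyMeasurable
      (ae_of_all _ fun x => hC x (mem_univ x))
  set F : Lp ℂ 2 (volume : Measure Torus) := (hf.ofReal (K := ℂ)).toLp _ with hF
  have hF' : F =ᵐ[volume] fun x => (f x : ℂ) := (hf.ofReal (K := ℂ)).coeFn_toLp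
  have hdense := (ContinuousMap.toLp_denseRange ℂ (volume : Measure Torus) ℂ
    (p := 2) (by norm_num)).topologicalClosure_map_submodule span_character_closure_eq_top
  have hzero : F = 0 := by
    -- The real and imaginary parts of the pairing with a character are, up to sign, the cosine and
    -- sine coefficients, so `F` is orthogonal to a dense subspace.
    have : F ∈ (Submodule.map (ContinuousMap.toLp 2 (volume : Measure Torus) ℂ).toLinearMap
        (Submodule.span ℂ (range character)))ᗮ := by
      rw [Submodule.map_span, Submodule.mem_orthogonal]
      intro w hw
      induction hw using Submodule.span_induction with
      | zero => simp
      | add x y _ _ hx hy => rw [inner_add_left, hx, hy, add_zero]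
      | smul a x _ hx => rw [inner_smul_left, hx, mul_zero]
      | mem w hw =>
        obtain ⟨_, ⟨k, rfl⟩, rfl⟩ := hw
        rw [L2.inner_def]
        have h1 : ∀ᵐ x, inner ℂ ((ContinuousMap.toLp 2 (volume : Measure Torus) ℂ
            (character k)) x) (F x) = ((f x * cosMode k x : ℝ) : ℂ)
              - ((f x * sinMode k x : ℝ) : ℂ) * Complex.I := by
          filter_upwards [hF', ContinuousMap.coeFn_toLp (p := 2) (𝕜 := ℂ)
            (volume : Measure Torus) (character k)] with x hx hx'
          rw [hx, hx', RCLike.inner_apply]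
          apply Complex.ext <;> simp [cosMode, sinMode]
        have e := integral_congr_ae h1
        refine e.trans ?_
        rw [integral_sub, integral_mul_const, integral_complex_ofReal, integral_complex_ofReal, hc, hs]
        · simp
        · exact (hfi (isSmooth_cosMode k).continuous).ofReal
        · exact (hfi (isSmooth_sinMode k).continuous).ofReal.mul_const _
    rw [← Submodule.orthogonal_closure] at this
    erw [hdense] at this
    simpa using this
  rw [hzero] at hF'
  filter_upwards [hF', Lp.coeFn_zero ℂ 2 (volume : Measure Torus)] with x h1 h2
  rw [h2] at h1
  simpa using h1.symm

/-! ### Calculus of smooth functions on the torus -/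

lemma IsSmooth.add {φ ψ : Torus → ℝ} (hφ : IsSmooth φ) (hψ : IsSmooth ψ) :
    IsSmooth (fun x => φ x + ψ x) := ContDiff.add hφ hψ

lemma IsSmooth.mul {φ ψ : Torus → ℝ} (hφ : IsSmooth φ) (hψ : IsSmooth ψ) :
    IsSmooth (fun x => φ x * ψ x) := ContDiff.mul hφ hψ

lemma isSmooth_const (c : ℝ) : IsSmooth (fun _ => c) :=
  (contDiff_const : ContDiff ℝ ∞ fun _ : Fin 3 → ℝ => c)

lemma IsSmooth.sum {ι : Type} [Fintype ι] {φ : ι → Torus → ℝ} (hφ : ∀ i, IsSmooth (φ i)) :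
    IsSmooth (fun x => ∑ i, φ i x) := ContDiff.sum fun i _ => hφ i

@[simp] lemma cover_zero : cover 0 = 0 := by
  funext i; simp [cover]

lemma IsSmooth.hasDerivAt {φ : Torus → ℝ} (h : IsSmooth φ) (j : Fin 3) (x : Torus) (s : ℝ) :
    HasDerivAt (fun s : ℝ => φ (x + cover (Pi.single j s)))
      (pderiv j φ (x + cover (Pi.single j s))) s := by
  obtain ⟨y, rfl⟩ := surjective_cover x
  have hd : DifferentiableAt ℝ (fun y : Fin 3 → ℝ => φ (cover y)) (y + Pi.single j s) :=
    (ContDiff.differentiable h (by simp)) _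
  simp only [← cover_add]
  rw [pderiv_cover h]
  have hp : HasDerivAt (fun s : ℝ => y + (Pi.single j s : Fin 3 → ℝ)) (Pi.single j 1) s := by
    have : HasDerivAt (fun s : ℝ => y + s • (Pi.single j (1 : ℝ) : Fin 3 → ℝ))
        ((1 : ℝ) • Pi.single j 1) s := ((hasDerivAt_id s).smul_const _).const_add y
    simpa [← Pi.single_smul] using this
  exact hd.hasFDerivAt.comp_hasDerivAt s hp

lemma IsSmooth.hasDerivAt_zero {φ : Torus → ℝ} (h : IsSmooth φ) (j : Fin 3) (x : Torus) :
    HasDerivAt (fun s : ℝ => φ (x + cover (Pi.single j s))) (pderiv j φ x) 0 := by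
  simpa using h.hasDerivAt j x 0

lemma pderiv_add {φ ψ : Torus → ℝ} (hφ : IsSmooth φ) (hψ : IsSmooth ψ) (j : Fin 3) (x : Torus) :
    pderiv j (fun x => φ x + ψ x) x = pderiv j φ x + pderiv j ψ x :=
  ((hφ.hasDerivAt_zero j x).add (hψ.hasDerivAt_zero j x)).deriv

lemma pderiv_mul {φ ψ : Torus → ℝ} (hφ : IsSmooth φ) (hψ : IsSmooth ψ) (j : Fin 3) (x : Torus) :
    pderiv j (fun x => φ x * ψ x) x = pderiv j φ x * ψ x + φ x * pderiv j ψ x := by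
  have := ((hφ.hasDerivAt_zero j x).fun_mul (hψ.hasDerivAt_zero j x)).deriv
  simp only [Pi.single_zero, cover_zero, add_zero] at this
  exact this

lemma pderiv_const_mul {φ : Torus → ℝ} (c : ℝ) (hφ : IsSmooth φ) (j : Fin 3) (x : Torus) :
    pderiv j (fun x => c * φ x) x = c * pderiv j φ x :=
  ((hφ.hasDerivAt_zero j x).const_mul c).deriv

lemma pderiv_sum {ι : Type} [Fintype ι] {φ : ι → Torus → ℝ} (hφ : ∀ i, IsSmooth (φ i))
    (j : Fin 3) (x : Torus) :
    pderiv j (fun x => ∑ i, φ i x) x = ∑ i, pderiv j (φ i) x :=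
  (HasDerivAt.fun_sum fun i _ => (hφ i).hasDerivAt_zero j x).deriv

lemma integrable_of_continuous {f : Torus → ℝ} (hf : Continuous f) : Integrable f := by
  obtain ⟨C, hC⟩ := isCompact_univ.exists_bound_of_continuousOn hf.continuousOn
  exact (MemLp.of_bound hf.aestronglyMeasurable C
    (ae_of_all _ fun x => hC x (mem_univ x)) : MemLp f 1 _).integrable le_rfl

lemma integrable_mul_of_continuous {f g : Torus → ℝ} (hf : Continuous f) (hg : Continuous g) :
    Integrable (fun x => f x * g x) := integrable_of_continuous (hf.mul hg)

/-- By translation invariance the integral of a shifted function does not depend on the shift;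
differentiate it under the integral sign. -/
lemma integral_pderiv {φ : Torus → ℝ} (hφ : IsSmooth φ) (j : Fin 3) :
    ∫ x, pderiv j φ x = 0 := by
  obtain ⟨C, hC⟩ := isCompact_univ.exists_bound_of_continuousOn
    (hφ.continuous_pderiv j).continuousOn
  have hcont : ∀ {ψ : Torus → ℝ}, Continuous ψ → ∀ s : ℝ,
      Continuous (fun x => ψ (x + cover (Pi.single j s))) := fun hψ s => by fun_prop
  have h := (hasDerivAt_integral_of_dominated_loc_of_deriv_le (μ := (volume : Measure Torus))
    (F := fun s x => φ (x + cover (Pi.single j s)))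
    (F' := fun s x => pderiv j φ (x + cover (Pi.single j s))) (x₀ := (0 : ℝ))
    (s := univ) (bound := fun _ => C) univ_mem
    (Eventually.of_forall fun s => (hcont hφ.continuous s).aestronglyMeasurable)
    (integrable_of_continuous (hcont hφ.continuous 0))
    (hcont (hφ.continuous_pderiv j) 0).aestronglyMeasurable
    (ae_of_all _ fun x s _ => hC _ (mem_univ _)) (integrable_const _)
    (ae_of_all _ fun x s _ => hφ.hasDerivAt j x s)).2
  have hconst : (fun s : ℝ => ∫ x, φ (x + cover (Pi.single j s))) = fun _ => ∫ x, φ x := by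
    funext s
    exact integral_add_right_eq_self (fun x => φ x) _
  rw [hconst] at h
  have := h.unique (hasDerivAt_const _ _)
  simpa using this

lemma integral_mul_pderiv {φ ψ : Torus → ℝ} (hφ : IsSmooth φ) (hψ : IsSmooth ψ) (j : Fin 3) :
    ∫ x, φ x * pderiv j ψ x = - ∫ x, pderiv j φ x * ψ x := by
  have h := integral_pderiv (hφ.mul hψ) j
  simp only [pderiv_mul hφ hψ] at h
  rw [integral_add (integrable_mul_of_continuous (hφ.continuous_pderiv j) hψ.continuous)
    (integrable_mul_of_continuous hφ.continuous (hψ.continuous_pderiv j))] at h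
  linarith

/-! ### Smooth divergence free fields -/

/-- `v` is represented by the smooth components `f i`. -/
structure Represents (f : Fin 3 → Torus → ℝ) (v : V) : Prop where
  smooth : ∀ i, IsSmooth (f i)
  vel_ae : ∀ᵐ x, ∀ i, (vel v : L2Vec) x i = f i x
  grad_ae : ∀ᵐ x, ∀ i j, grad v x (i, j) = pderiv j (f i) x

/-- The smooth divergence free fields. -/
def smoothFields : Submodule ℝ V where
  carrier := {v | ∃ f, Represents f v}
  zero_mem' := by
    refine ⟨fun _ _ => 0, fun i => isSmooth_const 0, coord_zero (Fin 3), ?_⟩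
    filter_upwards [coord_zero (Fin 3 × Fin 3)] with x hx i j
    exact (hx (i, j)).trans (by simp [pderiv])
  add_mem' := by
    rintro v w ⟨f, hf⟩ ⟨h, hh⟩
    refine ⟨fun i x => f i x + h i x, fun i => (hf.smooth i).add (hh.smooth i), ?_, ?_⟩
    · filter_upwards [coord_add (vel v : L2Vec) (vel w), hf.vel_ae, hh.vel_ae] with x h1 h2 h3 i
      rw [← h2, ← h3]; exact h1 i
    · filter_upwards [coord_add (grad v) (grad w), hf.grad_ae, hh.grad_ae] with x h1 h2 h3 i j
      rw [pderiv_add (hf.smooth i) (hh.smooth i), ← h2, ← h3]; exact h1 (i, j)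
  smul_mem' := by
    rintro c v ⟨f, hf⟩
    refine ⟨fun i x => c * f i x, fun i => (isSmooth_const c).mul (hf.smooth i), ?_, ?_⟩
    · filter_upwards [coord_smul c (vel v : L2Vec), hf.vel_ae] with x h1 h2 i
      rw [← h2]; exact h1 i
    · filter_upwards [coord_smul c (grad v), hf.grad_ae] with x h1 h2 i j
      rw [pderiv_const_mul c (hf.smooth i), ← h2]; exact h1 (i, j)

lemma exists_represents {f : Fin 3 → Torus → ℝ} (hf : ∀ i, IsSmooth (f i))
    (hdiv : ∀ x, ∑ i, pderiv i (f i) x = 0) : ∃ v : V, Represents f v ∧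
      (vel v : L2Vec) = ofCont f (fun i => (hf i).continuous) ∧
      grad v = ofCont (fun p : Fin 3 × Fin 3 => pderiv p.2 (f p.1))
        (fun p => (hf p.1).continuous_pderiv p.2) := by
  have ha := ofCont_ae (fun i => (hf i).continuous)
  have hb := ofCont_ae (f := fun p : Fin 3 × Fin 3 => pderiv p.2 (f p.1))
    (fun p => (hf p.1).continuous_pderiv p.2)
  refine ⟨⟨WithLp.toLp 2 (ofCont f (fun i => (hf i).continuous),
    ofCont (fun p : Fin 3 × Fin 3 => pderiv p.2 (f p.1))
      (fun p => (hf p.1).continuous_pderiv p.2)), ?_, ?_⟩, ⟨hf, ha, ?_⟩, rfl, rfl⟩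
  · intro φ hφ
    have h1 : ∫ x, ∑ i, ofCont f (fun i => (hf i).continuous) x i * pderiv i φ x
        = ∫ x, ∑ i, f i x * pderiv i φ x := by
      refine integral_congr_ae ?_
      filter_upwards [ha] with x hx
      simp only [hx]
    refine h1.trans ?_
    rw [integral_finsetSum _ fun i _ => integrable_mul_of_continuous
      (hf i).continuous (hφ.continuous_pderiv i)]
    simp only [fun i => integral_mul_pderiv (hf i) hφ i]
    rw [Finset.sum_neg_distrib, ← integral_finsetSum _ fun i _ => integrable_mul_of_continuous
      ((hf i).continuous_pderiv i) hφ.continuous]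
    simp only [← Finset.sum_mul, hdiv, zero_mul, integral_zero, neg_zero]
  · intro φ hφ i j
    have h1 : ∫ x, ofCont f (fun i => (hf i).continuous) x i * pderiv j φ x
        = ∫ x, f i x * pderiv j φ x := by
      refine integral_congr_ae ?_
      filter_upwards [ha] with x hx
      simp only [hx]
    refine h1.trans ?_
    rw [integral_mul_pderiv (hf i) hφ j]
    congr 1
    refine integral_congr_ae ?_
    filter_upwards [hb] with x hx
    exact congrArg (· * φ x) (hx (i, j)).symm
  · filter_upwards [hb] with x hx i j
    exact hx (i, j)

/-- A pair of trigonometric modes with wave vector `k`, exchanged by differentiation. -/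
structure ModePair (k : Fin 3 → ℤ) (ε : ℝ) (φ ψ : Torus → ℝ) : Prop where
  sq : ε * ε = 1
  left : IsSmooth φ
  right : IsSmooth ψ
  pderiv_left : ∀ j x, pderiv j φ x = ε * k j * ψ x
  pderiv_right : ∀ j x, pderiv j ψ x = -(ε * k j) * φ x

lemma modePair_cos (k : Fin 3 → ℤ) : ModePair k (-1) (cosMode k) (sinMode k) :=
  ⟨by norm_num, isSmooth_cosMode k, isSmooth_sinMode k,
    fun j x => by rw [pderiv_cosMode]; ring, fun j x => by rw [pderiv_sinMode]; ring⟩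

lemma modePair_sin (k : Fin 3 → ℤ) : ModePair k 1 (sinMode k) (cosMode k) :=
  ⟨by norm_num, isSmooth_sinMode k, isSmooth_cosMode k,
    fun j x => by rw [pderiv_sinMode]; ring, fun j x => by rw [pderiv_cosMode]; ring⟩

section Mode

variable {k : Fin 3 → ℤ} {ε : ℝ} {φ ψ : Torus → ℝ}

/-- The field `a φ` with `a ⊥ k` is solenoidal and an eigenfield of `-Δ` with eigenvalue `|k|²`. For
the gradient pairing, differentiating `φ` produces `ψ`, and the weak gradient tested with `ψ` gives
back `φ`. -/
lemma ModePair.exists_field (h : ModePair k ε φ ψ) {a : Fin 3 → ℝ} (ha : ∑ i, a i * k i = 0) :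
    ∃ w ∈ smoothFields, (∀ u : L2Vec, inner ℝ u (vel w : L2Vec) = ∑ i, a i * ∫ x, u x i * φ x) ∧
      ∀ v : V, inner ℝ (grad v) (grad w)
        = (∑ j, (k j : ℝ) ^ 2) * ∑ i, a i * ∫ x, (vel v : L2Vec) x i * φ x := by
  have hs : ∀ i, IsSmooth (fun x => a i * φ x) := fun i => (isSmooth_const _).mul h.left
  have hdiv : ∀ x, ∑ i, pderiv i (fun x => a i * φ x) x = 0 := by
    intro x
    have : ∀ i, pderiv i (fun x => a i * φ x) x = (a i * k i) * (ε * ψ x) := fun i => by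
      rw [pderiv_const_mul _ h.left, h.pderiv_left]; ring
    simp only [this, ← Finset.sum_mul, ha, zero_mul]
  obtain ⟨w, hw, h1, h2⟩ := exists_represents hs hdiv
  refine ⟨w, ⟨_, hw⟩, fun u => ?_, fun v => ?_⟩
  · rw [h1, inner_ofCont_sum]
    refine Finset.sum_congr rfl fun i _ => ?_
    rw [← integral_const_mul]
    exact integral_congr_ae (ae_of_all _ fun x => by ring)
  · rw [h2, inner_ofCont_sum, Fintype.sum_prod_type_right, Finset.sum_mul]
    refine Finset.sum_congr rfl fun j _ => ?_
    rw [Finset.mul_sum]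
    refine Finset.sum_congr rfl fun i _ => ?_
    have e1 : ∫ x, grad v x (i, j) * pderiv j (fun x => a i * φ x) x
        = (a i * ε * k j) * ∫ x, grad v x (i, j) * ψ x := by
      rw [← integral_const_mul]
      refine integral_congr_ae (ae_of_all _ fun x => ?_)
      simp only [pderiv_const_mul _ h.left, h.pderiv_left]
      ring
    have e2 : ∫ x, (vel v : L2Vec) x i * pderiv j ψ x
        = -(ε * k j) * ∫ x, (vel v : L2Vec) x i * φ x := by
      rw [← integral_const_mul]
      refine integral_congr_ae (ae_of_all _ fun x => ?_)
      simp only [h.pderiv_right]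
      ring
    have e3 : ∫ x, (vel v : L2Vec) x i * pderiv j ψ x = - ∫ x, grad v x (i, j) * ψ x :=
      v.2.2 ψ h.right i j
    rw [e1]
    have e4 : ∫ x, grad v x (i, j) * ψ x = (ε * k j) * ∫ x, (vel v : L2Vec) x i * φ x := by
      linarith
    rw [e4]
    linear_combination (a i * (k j : ℝ) ^ 2 * ∫ x, (vel v : L2Vec) x i * φ x) * h.sq

/-- Testing the divergence with the conjugate mode `ψ` shows that the coefficient vector is
orthogonal to `k`. -/
lemma ModePair.sum_eq_zero (h : ModePair k ε φ ψ) (u : H0) :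
    ∑ i, (∫ x, (u : L2Vec) x i * φ x) * k i = 0 := by
  have h0 : ∫ x, ∑ i, (u : L2Vec) x i * pderiv i ψ x = 0 := u.2 ψ h.right
  rw [integral_finsetSum _ fun i _ => integrable_mul _ i (h.right.continuous_pderiv i)] at h0
  have h1 : ∀ i, ∫ x, (u : L2Vec) x i * pderiv i ψ x
      = -ε * ((∫ x, (u : L2Vec) x i * φ x) * k i) := fun i => by
    rw [← integral_mul_const, ← integral_const_mul]
    refine integral_congr_ae (ae_of_all _ fun x => ?_)
    simp only [h.pderiv_right]
    ring
  simp only [h1, ← Finset.mul_sum] at h0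
  rcases mul_eq_zero.1 h0 with h2 | h2
  · have := h.sq
    have h3 : ε = 0 := by linarith
    rw [h3] at this; norm_num at this
  · exact h2

/-- The coefficient vector is itself an admissible `a`, and this choice makes its sum of squares
vanish. -/
lemma ModePair.integral_eq_zero (h : ModePair k ε φ ψ) (u : H0)
    (hu : ∀ a : Fin 3 → ℝ, ∑ i, a i * k i = 0 → ∑ i, a i * ∫ x, (u : L2Vec) x i * φ x = 0)
    (i : Fin 3) : ∫ x, (u : L2Vec) x i * φ x = 0 := by
  have h1 := hu _ (h.sum_eq_zero u)
  exact mul_self_eq_zero.1 ((Finset.sum_eq_zero_iff_of_nonneg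
    fun i _ => mul_self_nonneg _).1 h1 i (Finset.mem_univ i))

end Mode

/-! ### Density of smooth solenoidal fields. -/

lemma memLp_coord {ι : Type} [Fintype ι] (u : Lp (EuclideanSpace ℝ ι) 2 (volume : Measure Torus))
    (i : ι) : MemLp (fun x => u x i) 2 (volume : Measure Torus) :=
  (EuclideanSpace.proj (𝕜 := ℝ) i).comp_memLp' (Lp.memLp u)

lemma eq_zero_of_modes {ι : Type} [Fintype ι]
    (u : Lp (EuclideanSpace ℝ ι) 2 (volume : Measure Torus))
    (h : ∀ (k : Fin 3 → ℤ) (ε : ℝ) (φ ψ : Torus → ℝ), ModePair k ε φ ψ → ∀ i,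
      ∫ x, u x i * φ x = 0) : u = 0 := by
  have hz : ∀ i, (fun x => u x i) =ᵐ[volume] 0 := fun i =>
    ae_eq_zero_of_modes (memLp_coord u i) (fun k => h k _ _ _ (modePair_cos k) i)
      (fun k => h k _ _ _ (modePair_sin k) i)
  refine Lp.ext ?_
  filter_upwards [ae_all_iff.2 hz, coord_zero ι] with x h1 h2
  ext i
  rw [h2]
  exact h1 i

lemma inner_V (v w : V) : inner ℝ v w = inner ℝ (vel v) (vel w) + inner ℝ (grad v) (grad w) :=
  WithLp.prod_inner_apply v.1 w.1

/-- Smooth divergence free fields are dense in `𝓗₀`. -/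
lemma smoothFields_map_closure : (smoothFields.map (velL : V →ₗ[ℝ] H0)).topologicalClosure = ⊤ := by
  rw [Submodule.topologicalClosure_eq_top_iff, eq_bot_iff]
  intro u hu
  rw [Submodule.mem_orthogonal'] at hu
  have : (u : L2Vec) = 0 := by
    refine eq_zero_of_modes _ fun k ε φ ψ h => h.integral_eq_zero u fun a ha => ?_
    obtain ⟨w, hw, h1, -⟩ := h.exists_field ha
    rw [← h1]
    exact hu _ ⟨w, hw, rfl⟩
  simpa using this

/-- Smooth divergence free fields are dense in `V`. -/
lemma smoothFields_closure : smoothFields.topologicalClosure = ⊤ := by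
  rw [Submodule.topologicalClosure_eq_top_iff, eq_bot_iff]
  intro v hv
  rw [Submodule.mem_orthogonal'] at hv
  have hvel : (vel v : L2Vec) = 0 := by
    refine eq_zero_of_modes _ fun k ε φ ψ h => h.integral_eq_zero (vel v) fun a ha => ?_
    obtain ⟨w, hw, h1, h2⟩ := h.exists_field ha
    have h3 := hv w hw
    rw [inner_V, Submodule.coe_inner, h1, h2] at h3
    -- On an eigenfield the `V` product is `1 + |k|²` times the `L²` product, so orthogonality in
    -- `V` yields orthogonality in `L²`.
    have h4 : (1 + ∑ j, (k j : ℝ) ^ 2) * ∑ i, a i * ∫ x, (vel v : L2Vec) x i * φ x = 0 := by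
      linarith
    exact (mul_eq_zero.1 h4).resolve_left (by positivity)
  have hgrad : grad v = 0 := by
    refine eq_zero_of_modes _ fun k ε φ ψ h => ?_
    rintro ⟨i, j⟩
    have h1 : ∫ x, (vel v : L2Vec) x i * pderiv j φ x = - ∫ x, grad v x (i, j) * φ x :=
      v.2.2 φ h.left i j
    have h2 : ∫ x, (vel v : L2Vec) x i * pderiv j φ x = 0 := by
      rw [hvel]
      refine integral_eq_zero_of_ae ?_
      filter_upwards [coord_zero (Fin 3)] with x hx
      exact (congrArg (· * pderiv j φ x) (hx i)).trans (zero_mul _)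
    linarith
  have : v = 0 := by
    apply Subtype.ext
    apply WithLp.ofLp_injective
    exact Prod.ext hvel hgrad
  simpa using this

/-! ### The inertial term -/

section FieldOfComponents

variable {ι : Type} [Fintype ι]

lemma memLp_field {f : ι → Torus → ℝ} (hf : ∀ i, MemLp (f i) 2 (volume : Measure Torus)) :
    MemLp (fun x => (WithLp.toLp 2 (fun i => f i x) : EuclideanSpace ℝ ι)) 2
      (volume : Measure Torus) := by
  classical
  have h : (fun x => (WithLp.toLp 2 (fun i => f i x) : EuclideanSpace ℝ ι))
      = fun x => ∑ i, (ContinuousLinearMap.toSpanSingleton ℝ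
        (EuclideanSpace.single i (1 : ℝ))) (f i x) := by
    funext x
    ext j
    simp [Finset.sum_apply, Pi.single_apply]
  rw [h]
  exact memLp_finsetSum _ fun i _ =>
    (ContinuousLinearMap.toSpanSingleton ℝ (EuclideanSpace.single i (1 : ℝ))).comp_memLp' (hf i)

/-- The square integrable field with components `f i`. -/
def fieldOf (f : ι → Torus → ℝ) (hf : ∀ i, MemLp (f i) 2 (volume : Measure Torus)) :
    Lp (EuclideanSpace ℝ ι) 2 (volume : Measure Torus) :=
  (memLp_field hf).toLp _

lemma fieldOf_ae {f : ι → Torus → ℝ} (hf : ∀ i, MemLp (f i) 2 (volume : Measure Torus)) :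
    ∀ᵐ x, ∀ i, fieldOf f hf x i = f i x := by
  filter_upwards [(memLp_field hf).coeFn_toLp] with x hx i
  rw [fieldOf, hx]

lemma inner_fieldOf {f : ι → Torus → ℝ} (hf : ∀ i, MemLp (f i) 2 (volume : Measure Torus))
    (u : Lp (EuclideanSpace ℝ ι) 2 (volume : Measure Torus)) :
    inner ℝ (fieldOf f hf) u = ∫ x, ∑ i, f i x * u x i := by
  rw [inner_eq_integral]
  refine integral_congr_ae ?_
  filter_upwards [fieldOf_ae hf] with x hx
  simp only [hx]

lemma memLp_mul_bdd {f b : Torus → ℝ} (hf : MemLp f 2 (volume : Measure Torus))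
    (hb : AEStronglyMeasurable b (volume : Measure Torus)) {C : ℝ} (hC : ∀ x, |b x| ≤ C) :
    MemLp (fun x => f x * b x) 2 (volume : Measure Torus) := by
  refine hf.of_le_mul (c := C) (hf.1.mul hb) (ae_of_all _ fun x => ?_)
  rw [norm_mul, mul_comm]
  exact mul_le_mul_of_nonneg_right (hC x) (norm_nonneg _)

lemma aestronglyMeasurable_coord (u : Lp (EuclideanSpace ℝ ι) 2 (volume : Measure Torus)) (i : ι) :
    AEStronglyMeasurable (fun x => u x i) (volume : Measure Torus) := (memLp_coord u i).1

end FieldOfComponents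

lemma exists_forall_abs_le {f : Torus → ℝ} (hf : Continuous f) : ∃ C, ∀ x, |f x| ≤ C := by
  obtain ⟨C, hC⟩ := isCompact_univ.exists_bound_of_continuousOn hf.continuousOn
  exact ⟨C, fun x => hC x (mem_univ x)⟩

lemma exists_forall_abs_le_of_finite {ι : Type} [Fintype ι] {f : ι → Torus → ℝ}
    (hf : ∀ i, Continuous (f i)) : ∃ C, ∀ i x, |f i x| ≤ C := by
  choose C hC using fun i => exists_forall_abs_le (hf i)
  have hC0 : ∀ i, 0 ≤ C i := fun i => (abs_nonneg _).trans (hC i 0)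
  exact ⟨∑ i, C i, fun i x => (hC i x).trans
    (Finset.single_le_sum (f := C) (fun i _ => hC0 i) (Finset.mem_univ i))⟩

lemma Represents.exists_bound {f : Fin 3 → Torus → ℝ} {w : V} (h : Represents f w) :
    ∃ C, ∀ i x, |f i x| ≤ C := exists_forall_abs_le_of_finite fun i => (h.smooth i).continuous

lemma forall_mem_V_of_smoothFields {P : V → Prop} (hP : IsClosed {v | P v})
    (h : ∀ v ∈ smoothFields, P v) (v : V) : P v := by
  have hv : v ∈ smoothFields.topologicalClosure := by
    rw [smoothFields_closure]; trivial
  exact closure_minimal (t := {v | P v}) h hP hv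

/-- For smooth `w` the inertial term is bounded by the kinetic energy. -/
lemma exists_inertial_le {w : V} (hw : w ∈ smoothFields) :
    ∃ C : ℝ, 0 ≤ C ∧ ∀ u : V, |inertial u u w| ≤ C * ‖vel u‖ ^ 2 := by
  obtain ⟨f, hf⟩ := hw
  obtain ⟨B, hB⟩ := hf.exists_bound
  obtain ⟨C, hC⟩ := exists_forall_abs_le_of_finite (ι := Fin 3 × Fin 3)
    (f := fun p => pderiv p.2 (f p.1)) fun p => (hf.smooth p.1).continuous_pderiv p.2
  have hC0 : 0 ≤ C := (abs_nonneg _).trans (hC (0, 0) 0)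
  refine ⟨9 * C, by positivity, fun u => ?_⟩
  have hP : ∀ p : Fin 3 × Fin 3, MemLp (fun x => (vel u : L2Vec) x p.2 * f p.1 x) 2
      (volume : Measure Torus) := fun p => memLp_mul_bdd (memLp_coord _ _)
        (hf.smooth p.1).continuous.aestronglyMeasurable (hB p.1)
  have hQ : ∀ i : Fin 3, MemLp (fun x => ∑ j, (vel u : L2Vec) x j * pderiv j (f i) x) 2
      (volume : Measure Torus) := fun i => memLp_finsetSum _ fun j _ =>
        memLp_mul_bdd (memLp_coord _ _)
          ((hf.smooth i).continuous_pderiv j).aestronglyMeasurable (hC (i, j))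
  have hinert : ∀ v : V, inertial u v w = inner ℝ (fieldOf _ hP) (grad v) := by
    intro v
    rw [inner_fieldOf, inertial]
    refine integral_congr_ae ?_
    filter_upwards [hf.vel_ae] with x hx
    rw [Fintype.sum_prod_type]
    refine Finset.sum_congr rfl fun i _ => Finset.sum_congr rfl fun j _ => ?_
    rw [hx i]; ring
  -- Integration by parts moves the derivative from `v` to `w`. With `u` and the bounded `w` fixed,
  -- both terms are continuous in `v`, so smooth `v` suffice; there the identity is `div u = 0`
  -- tested with `v · w`.
  have hibp : ∀ v : V, inertial u v w + inner ℝ (fieldOf _ hQ) (vel v : L2Vec) = 0 := by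
    refine forall_mem_V_of_smoothFields ?_ ?_
    · simp only [hinert]
      refine isClosed_eq ?_ continuous_const
      have h1 : Continuous fun v : V => grad v := gradL.continuous
      have h2 : Continuous fun v : V => (vel v : L2Vec) :=
        continuous_subtype_val.comp velL.continuous
      fun_prop
    · rintro v ⟨q, hq⟩
      have hs : ∀ i, IsSmooth (fun x => q i x * f i x) := fun i => (hq.smooth i).mul (hf.smooth i)
      have h0 : ∫ x, ∑ j, (vel u : L2Vec) x j * pderiv j (fun x => ∑ i, q i x * f i x) x = 0 :=
        (vel u).2 _ (IsSmooth.sum hs)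
      rw [hinert, inner_eq_integral, inner_eq_integral, ← integral_add, ← h0]
      · refine integral_congr_ae ?_
        filter_upwards [hq.vel_ae, hq.grad_ae, fieldOf_ae hP, fieldOf_ae hQ] with x h1 h2 h3 h4
        simp only [h1, h2, h3, h4, pderiv_sum hs, pderiv_mul (hq.smooth _) (hf.smooth _)]
        simp only [Fintype.sum_prod_type_right, Fin.sum_univ_three]
        ring
      · exact integrable_finsetSum _ fun p _ => (memLp_coord _ p).integrable_mul (memLp_coord _ p)
      · exact integrable_finsetSum _ fun i _ => (memLp_coord _ i).integrable_mul (memLp_coord _ i)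
  -- Each component is at most `3C|u|` pointwise, hence the field is at most `3√3 C|u|`; the
  -- constant `9` is generous.
  have hnorm : ‖fieldOf _ hQ‖ ≤ 9 * C * ‖(vel u : L2Vec)‖ := by
    refine Lp.norm_le_mul_norm_of_ae_le_mul ?_
    filter_upwards [fieldOf_ae hQ] with x hx
    have hi : ∀ i, |fieldOf _ hQ x i| ≤ 3 * C * ‖(vel u : L2Vec) x‖ := by
      intro i
      rw [hx]
      refine (Finset.abs_sum_le_sum_abs _ _).trans ?_
      have : ∀ j ∈ (Finset.univ : Finset (Fin 3)), |(vel u : L2Vec) x j * pderiv j (f i) x|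
          ≤ C * ‖(vel u : L2Vec) x‖ := by
        intro j _
        rw [abs_mul, mul_comm]
        exact mul_le_mul (hC (i, j) x) (PiLp.norm_apply_le ((vel u : L2Vec) x) j)
          (abs_nonneg _) hC0
      refine (Finset.sum_le_sum this).trans (le_of_eq ?_)
      simp; ring
    refine abs_le_of_sq_le_sq' ?_ (by positivity) |>.2
    rw [EuclideanSpace.norm_sq_eq]
    have h2 : ∀ i ∈ (Finset.univ : Finset (Fin 3)), ‖fieldOf _ hQ x i‖ ^ 2
        ≤ (3 * C * ‖(vel u : L2Vec) x‖) ^ 2 := fun i _ =>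
      pow_le_pow_left₀ (norm_nonneg _) (hi i) 2
    refine (Finset.sum_le_sum h2).trans ?_
    simp
    nlinarith [sq_nonneg (C * ‖(vel u : L2Vec) x‖)]
  have h1 : inertial u u w = - inner ℝ (fieldOf _ hQ) (vel u : L2Vec) := by
    linarith [hibp u]
  rw [h1, abs_neg]
  refine (abs_real_inner_le_norm _ _).trans ?_
  refine (mul_le_mul_of_nonneg_right hnorm (norm_nonneg _)).trans (le_of_eq ?_)
  rw [Submodule.coe_norm]; ring

/-- The bounded truncation `z ↦ z i / (1 + (d |z|)²)` of the coordinate `z i`. -/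
def trunc (d : ℝ) (z : EuclideanSpace ℝ (Fin 3)) (i : Fin 3) : ℝ :=
  z i / (1 + d ^ 2 * ∑ l, z l ^ 2)

lemma trunc_denom_pos (d : ℝ) (z : Fin 3 → ℝ) : 0 < 1 + d ^ 2 * ∑ l, z l ^ 2 := by
  have : 0 ≤ ∑ l, z l ^ 2 := Finset.sum_nonneg fun l _ => sq_nonneg _
  positivity

lemma continuous_trunc (d : ℝ) (i : Fin 3) : Continuous fun z => trunc d z i := by
  unfold trunc
  exact Continuous.div (by fun_prop) (by fun_prop) fun z => (trunc_denom_pos d z).ne'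

lemma abs_trunc_le {d : ℝ} (hd : 0 < d) (z : EuclideanSpace ℝ (Fin 3)) (i : Fin 3) :
    |trunc d z i| ≤ 1 / d := by
  rw [trunc, abs_div, abs_of_pos (trunc_denom_pos d z), div_le_div_iff₀ (trunc_denom_pos d z) hd]
  have h : z i ^ 2 ≤ ∑ l, z l ^ 2 :=
    Finset.single_le_sum (f := fun l => z l ^ 2) (fun l _ => sq_nonneg _) (Finset.mem_univ i)
  have h2 : d ^ 2 * z i ^ 2 ≤ d ^ 2 * ∑ l, z l ^ 2 := by gcongr
  rw [← sq_abs (z i)] at h2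
  nlinarith [sq_nonneg (|z i| * d - 1), abs_nonneg (z i)]

lemma memLp_trunc {d : ℝ} (hd : 0 < d) (u z : L2Vec) (p : Fin 3 × Fin 3) :
    MemLp (fun x => u x p.2 * trunc d (z x) p.1) 2 (volume : Measure Torus) :=
  memLp_mul_bdd (memLp_coord u _)
    ((continuous_trunc d _).comp_aestronglyMeasurable (Lp.aestronglyMeasurable z))
    fun _ => abs_trunc_le hd _ _

/-- Testing the divergence of `u` with `log (1 + (d |v|)²)`, for smooth `v`. -/
lemma inner_trunc_smooth {d : ℝ} (hd : 0 < d) (u : H0) {v : V} (hv : v ∈ smoothFields) :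
    inner ℝ (fieldOf _ (memLp_trunc hd (u : L2Vec) (vel v))) (grad v) = 0 := by
  obtain ⟨q, hq⟩ := hv
  set h : Torus → ℝ := fun x => Real.log (1 + d ^ 2 * ∑ l, q l x ^ 2) / (2 * d ^ 2) with hh
  have hpos : ∀ x, 0 < 1 + d ^ 2 * ∑ l, q l x ^ 2 := fun _ => trunc_denom_pos d _
  have hsm : IsSmooth h := by
    have : ∀ l, ContDiff ℝ ∞ fun y => q l (cover y) := hq.smooth
    have h1 : ContDiff ℝ ∞ fun y : Fin 3 → ℝ => 1 + d ^ 2 * ∑ l, q l (cover y) ^ 2 :=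
      contDiff_const.add (contDiff_const.mul (ContDiff.sum fun l _ => (this l).pow 2))
    exact (h1.log fun _ => (hpos _).ne').div_const _
  have hder : ∀ j x, pderiv j h x
      = (∑ l, q l x * pderiv j (q l) x) / (1 + d ^ 2 * ∑ l, q l x ^ 2) := by
    intro j x
    have h1 : HasDerivAt (fun s : ℝ => 1 + d ^ 2 * ∑ l, q l (x + cover (Pi.single j s)) ^ 2)
        (d ^ 2 * ∑ l, 2 * q l x * pderiv j (q l) x) 0 := by
      refine HasDerivAt.const_add _ (HasDerivAt.const_mul _ (HasDerivAt.fun_sum fun l _ => ?_))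
      simpa using ((hq.smooth l).hasDerivAt_zero j x).fun_pow 2
    have h2 := (h1.log (hpos _).ne').div_const (2 * d ^ 2)
    refine h2.deriv.trans ?_
    simp only [Pi.single_zero, cover_zero, add_zero]
    have h3 : ∑ l, 2 * q l x * pderiv j (q l) x = 2 * ∑ l, q l x * pderiv j (q l) x := by
      rw [Finset.mul_sum]; exact Finset.sum_congr rfl fun l _ => by ring
    rw [h3]
    have := (hpos x).ne'
    field_simp
  have h0 : ∫ x, ∑ j, (u : L2Vec) x j * pderiv j h x = 0 := u.2 h hsm
  rw [inner_fieldOf, ← h0]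
  refine integral_congr_ae ?_
  filter_upwards [hq.vel_ae, hq.grad_ae] with x h1 h2
  simp only [trunc, h1, h2, hder, Fintype.sum_prod_type_right]
  refine Finset.sum_congr rfl fun j _ => ?_
  generalize 1 + d ^ 2 * ∑ l, q l x ^ 2 = D
  rw [Finset.sum_div, Finset.mul_sum]
  exact Finset.sum_congr rfl fun i _ => by ring

/-- The truncation is continuous and bounded by `1/d`, so dominated convergence applies with the
majorant `(2/d)² |u|²`, summed over all index pairs. Almost everywhere convergence of `z` is enough.
-/
lemma tendsto_fieldOf_trunc {d : ℝ} (hd : 0 < d) (u : L2Vec) {z : ℕ → L2Vec} {z' : L2Vec}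
    (hz : ∀ᵐ x, Tendsto (fun n => z n x) atTop (𝓝 (z' x))) :
    Tendsto (fun n => fieldOf _ (memLp_trunc hd u (z n))) atTop
      (𝓝 (fieldOf _ (memLp_trunc hd u z'))) := by
  rw [tendsto_iff_norm_sub_tendsto_zero]
  have hsq : ∀ n, ‖fieldOf _ (memLp_trunc hd u (z n)) - fieldOf _ (memLp_trunc hd u z')‖ ^ 2
      = ∫ x, ∑ p : Fin 3 × Fin 3,
        (u x p.2 * trunc d (z n x) p.1 - u x p.2 * trunc d (z' x) p.1) ^ 2 := by
    intro n
    rw [← real_inner_self_eq_norm_sq, inner_eq_integral]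
    refine integral_congr_ae ?_
    filter_upwards [fieldOf_ae (memLp_trunc hd u (z n)), fieldOf_ae (memLp_trunc hd u z'),
      Lp.coeFn_sub (fieldOf _ (memLp_trunc hd u (z n))) (fieldOf _ (memLp_trunc hd u z'))]
      with x h1 h2 h3
    refine Finset.sum_congr rfl fun p _ => ?_
    rw [h3, Pi.sub_apply, PiLp.sub_apply, h1, h2, sq]
  have hlim : Tendsto (fun n => ∫ x, ∑ p : Fin 3 × Fin 3,
        (u x p.2 * trunc d (z n x) p.1 - u x p.2 * trunc d (z' x) p.1) ^ 2) atTop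
      (𝓝 (∫ _ : Torus, (0 : ℝ))) := by
    refine tendsto_integral_of_dominated_convergence
      (fun x => ∑ p : Fin 3 × Fin 3, (2 / d) ^ 2 * (u x p.2) ^ 2) ?_ ?_ ?_ ?_
    · intro n
      exact Finset.aestronglyMeasurable_fun_sum _ fun p _ =>
        ((memLp_trunc hd u (z n) p).1.sub (memLp_trunc hd u z' p).1).pow 2
    · exact integrable_finsetSum _ fun p _ => (memLp_coord u p.2).integrable_sq.const_mul _
    · intro n
      refine ae_of_all _ fun x => ?_
      rw [Real.norm_of_nonneg (Finset.sum_nonneg fun p _ => sq_nonneg _)]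
      refine Finset.sum_le_sum fun p _ => ?_
      rw [← mul_sub, mul_pow, mul_comm]
      refine mul_le_mul_of_nonneg_right ?_ (sq_nonneg _)
      refine sq_le_sq' ?_ ?_ <;>
      · have h1 := abs_le.1 (abs_trunc_le hd (z n x) p.1)
        have h2 := abs_le.1 (abs_trunc_le hd (z' x) p.1)
        have h3 : 2 / d = 1 / d + 1 / d := by ring
        linarith
    · filter_upwards [hz] with x hx
      have : Tendsto (fun n => ∑ p : Fin 3 × Fin 3,
          (u x p.2 * trunc d (z n x) p.1 - u x p.2 * trunc d (z' x) p.1) ^ 2) atTop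
          (𝓝 (∑ p : Fin 3 × Fin 3,
          (u x p.2 * trunc d (z' x) p.1 - u x p.2 * trunc d (z' x) p.1) ^ 2)) := by
        refine tendsto_finsetSum _ fun p _ => ?_
        exact (((((continuous_trunc d p.1).tendsto _).comp hx).const_mul _).sub_const _).pow 2
      simpa using this
  simp only [integral_zero, ← hsq] at hlim
  simpa using hlim.sqrt

/-- The transporting field `u` stays fixed while the truncated field and the gradient are
approximated by smooth fields. Along a subsequence the velocities converge almost everywhere, so
both factors converge strongly in `L²`. -/
lemma inner_trunc_eq_zero {d : ℝ} (hd : 0 < d) (u : V) :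
    inner ℝ (fieldOf _ (memLp_trunc hd (vel u : L2Vec) (vel u))) (grad u) = 0 := by
  have hu : u ∈ closure (smoothFields : Set V) := by
    rw [← Submodule.topologicalClosure_coe, smoothFields_closure]; trivial
  obtain ⟨v, hv, hlim⟩ := mem_closure_iff_seq_limit.1 hu
  have h1 : Tendsto (fun n => (vel (v n) : L2Vec)) atTop (𝓝 (vel u : L2Vec)) :=
    ((continuous_subtype_val.comp velL.continuous).tendsto u).comp hlim
  have h2 : Tendsto (fun n => grad (v n)) atTop (𝓝 (grad u)) :=
    (gradL.continuous.tendsto u).comp hlim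
  obtain ⟨ns, hns, hae⟩ := (tendstoInMeasure_of_tendsto_Lp h1).exists_seq_tendsto_ae
  have h3 := (tendsto_fieldOf_trunc hd (vel u : L2Vec) hae).inner (𝕜 := ℝ)
    (h2.comp hns.tendsto_atTop)
  refine tendsto_nhds_unique h3 ?_
  have : ∀ n, inner ℝ (fieldOf _ (memLp_trunc hd (vel u : L2Vec) (vel (v (ns n)))))
      (grad (v (ns n))) = 0 := fun n => inner_trunc_smooth hd (vel u) (hv (ns n))
  simp only [Function.comp_def, this]
  exact tendsto_const_nhds

/-- The inertial term does not contribute to the energy balance. The Sobolev embedding `H¹ ⊂ L⁴`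
makes the integrand integrable; this is not needed, since dominated convergence along the truncations
uses nothing but the integrability of the integrand itself. -/
lemma inertial_self (u : V) : inertial u u u = 0 := by
  set S : Torus → ℝ := fun x =>
    ∑ i, ∑ j, (vel u : L2Vec) x j * grad u x (i, j) * (vel u : L2Vec) x i with hS
  -- If the integrand were not integrable, its integral would be `0` by convention.
  by_cases hint : Integrable S
  swap
  · exact integral_undef hint
  set θ : ℕ → Torus → ℝ := fun n x =>
    (1 + (1 / ((n : ℝ) + 1)) ^ 2 * ∑ l, (vel u : L2Vec) x l ^ 2)⁻¹ with hθ
  have hpos : ∀ n x, 0 < 1 + (1 / ((n : ℝ) + 1)) ^ 2 * ∑ l, (vel u : L2Vec) x l ^ 2 :=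
    fun n x => trunc_denom_pos _ _
  have hθ1 : ∀ n x, ‖θ n x‖ ≤ 1 := by
    intro n x
    rw [Real.norm_of_nonneg (inv_nonneg.2 (hpos n x).le)]
    refine inv_le_one_of_one_le₀ ?_
    have : 0 ≤ ∑ l, (vel u : L2Vec) x l ^ 2 := Finset.sum_nonneg fun l _ => sq_nonneg _
    have : 0 ≤ (1 / ((n : ℝ) + 1)) ^ 2 * ∑ l, (vel u : L2Vec) x l ^ 2 := by positivity
    linarith
  have hzero : ∀ n, ∫ x, θ n x * S x = 0 := by
    intro n
    have hd : 0 < 1 / ((n : ℝ) + 1) := by positivity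
    rw [← inner_trunc_eq_zero hd u, inner_fieldOf]
    refine integral_congr_ae (ae_of_all _ fun x => ?_)
    simp only [hθ, hS, trunc, Fintype.sum_prod_type, Finset.mul_sum]
    refine Finset.sum_congr rfl fun i _ => Finset.sum_congr rfl fun j _ => ?_
    rw [div_eq_mul_inv]; ring
  have hlim : Tendsto (fun n => ∫ x, θ n x * S x) atTop (𝓝 (∫ x, S x)) := by
    refine tendsto_integral_of_dominated_convergence (fun x => ‖S x‖) ?_ hint.norm ?_ ?_
    · intro n
      refine AEStronglyMeasurable.mul ?_ hint.1
      have : AEMeasurable (fun x => 1 + (1 / ((n : ℝ) + 1)) ^ 2 * ∑ l, (vel u : L2Vec) x l ^ 2)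
          (volume : Measure Torus) :=
        ((Finset.aestronglyMeasurable_fun_sum _ fun l _ =>
          (aestronglyMeasurable_coord (vel u : L2Vec) l).pow 2).aemeasurable.const_mul _).const_add _
      exact this.inv.aestronglyMeasurable
    · intro n
      refine ae_of_all _ fun x => ?_
      rw [norm_mul]
      exact mul_le_of_le_one_left (norm_nonneg _) (hθ1 n x)
    · refine ae_of_all _ fun x => ?_
      have h1 : Tendsto (fun n : ℕ => 1 / ((n : ℝ) + 1)) atTop (𝓝 0) :=
        tendsto_one_div_add_atTop_nhds_zero_nat
      have h2 : Tendsto (fun n => θ n x) atTop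
          (𝓝 (1 + (0 : ℝ) ^ 2 * ∑ l, (vel u : L2Vec) x l ^ 2)⁻¹) :=
        (((h1.pow 2).mul_const _).const_add 1).inv₀ (by simp)
      simpa using h2.mul_const (S x)
  simp only [hzero] at hlim
  exact tendsto_nhds_unique hlim tendsto_const_nhds

/-! ### Energy balance -/

section Energy

variable {γ : ℝ} {g : L2Vec} {α : ℝ} {u : ℝ → V}

lemma innerH_self (α : ℝ) (v : V) : innerH α v v = normSqH α v := by
  simp only [innerH, normSqH, real_inner_self_eq_norm_sq]

lemma norm_vel_sq_le {α : ℝ} (hα : 0 ≤ α) (v : V) : ‖vel v‖ ^ 2 ≤ normSqH α v := by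
  have := mul_nonneg hα (sq_nonneg ‖grad v‖)
  unfold normSqH; linarith

lemma normSqH_nonneg {α : ℝ} (hα : 0 ≤ α) (v : V) : 0 ≤ normSqH α v :=
  (sq_nonneg _).trans (norm_vel_sq_le hα v)

lemma IsSolution.hasDerivWithinAt (h : IsSolution γ g α u) {t : ℝ} (ht : 0 ≤ t) :
    HasDerivWithinAt u (derivWithin u (Ici 0) t) (Ici 0) t :=
  (h.contDiffOn.differentiableOn (by simp) t ht).hasDerivWithinAt

lemma IsSolution.hasDerivWithinAt_vel (h : IsSolution γ g α u) {t : ℝ} (ht : 0 ≤ t) :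
    HasDerivWithinAt (fun s => vel (u s)) (vel (derivWithin u (Ici 0) t)) (Ici 0) t :=
  velL.hasFDerivAt.comp_hasDerivWithinAt t (h.hasDerivWithinAt ht)

lemma IsSolution.hasDerivWithinAt_grad (h : IsSolution γ g α u) {t : ℝ} (ht : 0 ≤ t) :
    HasDerivWithinAt (fun s => grad (u s)) (grad (derivWithin u (Ici 0) t)) (Ici 0) t :=
  gradL.hasFDerivAt.comp_hasDerivWithinAt t (h.hasDerivWithinAt ht)

lemma IsSolution.continuousOn_vel (h : IsSolution γ g α u) :
    ContinuousOn (fun s => vel (u s)) (Ici 0) :=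
  fun _ ht => (h.hasDerivWithinAt_vel ht).continuousWithinAt

lemma IsSolution.hasDerivWithinAt_energy (h : IsSolution γ g α u) {t : ℝ} (ht : 0 ≤ t) :
    HasDerivWithinAt (fun s => normSqH α (u s))
      (2 * (inner ℝ g (vel (u t) : L2Vec) - γ * normSqH α (u t))) (Ici 0) t := by
  have h1 := (h.hasDerivWithinAt_vel ht).norm_sq.add
    ((h.hasDerivWithinAt_grad ht).norm_sq.const_mul α)
  refine h1.congr_deriv ?_
  have h2 := h.equation t ht (u t)
  rw [inertial_self, innerH_self] at h2
  rw [← h2, innerH, real_inner_comm (vel (u t)), real_inner_comm (grad (u t))]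
  ring

/-- Half of the damping absorbs the work of `g` by Young's inequality; the other half makes `exp
(γt) (E - ‖g‖²/γ²)` nonincreasing. -/
lemma IsSolution.energy_le (h : IsSolution γ g α u) (hγ : 0 < γ) (hα : 0 ≤ α) {t : ℝ}
    (ht : 0 ≤ t) : normSqH α (u t) ≤ normSqH α (u 0) + ‖g‖ ^ 2 / γ ^ 2 := by
  set B := ‖g‖ ^ 2 / γ ^ 2 with hB
  have hBγ : γ * B = ‖g‖ ^ 2 / γ := by rw [hB]; field_simp
  have hder : ∀ s, 0 ≤ s → HasDerivWithinAt (fun s => Real.exp (γ * s) * (normSqH α (u s) - B))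
      (Real.exp (γ * s) * γ * (normSqH α (u s) - B) + Real.exp (γ * s) *
        (2 * (inner ℝ g (vel (u s) : L2Vec) - γ * normSqH α (u s)))) (Ici 0) s := by
    intro s hs
    have h1 : HasDerivAt (fun s => Real.exp (γ * s)) (Real.exp (γ * s) * γ) s := by
      simpa using ((hasDerivAt_id s).const_mul γ).exp
    exact h1.hasDerivWithinAt.mul ((h.hasDerivWithinAt_energy hs).sub_const B)
  have hanti : AntitoneOn (fun s => Real.exp (γ * s) * (normSqH α (u s) - B)) (Ici 0) := by
    refine antitoneOn_of_hasDerivWithinAt_nonpos (convex_Ici 0)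
      (fun s hs => (hder s hs).continuousWithinAt)
      (fun s hs => (hder s (interior_subset hs)).mono interior_subset) ?_
    intro s _
    have h1 : inner ℝ g (vel (u s) : L2Vec) ≤ ‖g‖ * ‖vel (u s)‖ := real_inner_le_norm _ _
    have h2 : 2 * (‖g‖ * ‖vel (u s)‖) ≤ ‖g‖ ^ 2 / γ + γ * ‖vel (u s)‖ ^ 2 := by
      have h3 : ‖g‖ ^ 2 / γ + γ * ‖vel (u s)‖ ^ 2 - 2 * (‖g‖ * ‖vel (u s)‖)
          = (‖g‖ - γ * ‖vel (u s)‖) ^ 2 / γ := by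
        field_simp; ring
      have h4 : 0 ≤ (‖g‖ - γ * ‖vel (u s)‖) ^ 2 / γ := by positivity
      linarith
    have h5 : γ * ‖vel (u s)‖ ^ 2 ≤ γ * normSqH α (u s) :=
      mul_le_mul_of_nonneg_left (norm_vel_sq_le hα _) hγ.le
    have h6 : γ * (normSqH α (u s) - B) + 2 * (inner ℝ g (vel (u s) : L2Vec)
        - γ * normSqH α (u s)) ≤ 0 := by
      rw [mul_sub, hBγ]; linarith
    nlinarith [Real.exp_pos (γ * s)]
  have h1 := hanti (mem_Ici.2 le_rfl) (mem_Ici.2 ht) ht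
  simp only [mul_zero, Real.exp_zero, one_mul] at h1
  have h2 : 1 ≤ Real.exp (γ * t) := Real.one_le_exp (by positivity)
  have h0 := normSqH_nonneg hα (u 0)
  have hB0 : 0 ≤ B := by positivity
  by_contra hcon
  push Not at hcon
  nlinarith

/-- The density whose time integral against the velocity is the weighted work of the force `g`. -/
def weight (γ : ℝ) (g : L2Vec) (s : ℝ) : H0 :=
  (2 * Real.exp (2 * γ * s)) • H0.orthogonalProjectionOnto g

lemma continuous_weight (γ : ℝ) (g : L2Vec) : Continuous (weight γ g) := by
  unfold weight; fun_prop

/-- Projecting `g` loses nothing against solenoidal fields, and it makes `weight` an `𝓗₀`-valued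
test function for weak-star convergence. -/
lemma inner_weight (γ : ℝ) (g : L2Vec) (s : ℝ) (v : H0) :
    inner ℝ v (weight γ g s) = 2 * Real.exp (2 * γ * s) * inner ℝ g (v : L2Vec) := by
  have h := real_inner_smul_right v (H0.orthogonalProjectionOnto g) (2 * Real.exp (2 * γ * s))
  rw [Submodule.inner_orthogonalProjectionOnto_eq_of_mem_left, real_inner_comm g] at h
  exact h

lemma IsSolution.continuousOn_work (h : IsSolution γ g α u) :
    ContinuousOn (fun s => inner ℝ (vel (u s)) (weight γ g s)) (Ici 0) :=
  h.continuousOn_vel.inner (𝕜 := ℝ) (continuous_weight γ g).continuousOn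

/-- The factor `exp (2γs)` cancels the damping exactly. What remains under the integral is linear in
the velocity and therefore stable under weak limits. -/
lemma IsSolution.energy_eq (h : IsSolution γ g α u) {t : ℝ} (ht : 0 ≤ t) :
    Real.exp (2 * γ * t) * normSqH α (u t) - normSqH α (u 0)
      = ∫ s in Icc 0 t, inner ℝ (vel (u s)) (weight γ g s) := by
  have hder : ∀ s, 0 ≤ s → HasDerivWithinAt (fun s => Real.exp (2 * γ * s) * normSqH α (u s))
      (inner ℝ (vel (u s)) (weight γ g s)) (Ici 0) s := by
    intro s hs
    have h1 : HasDerivAt (fun s => Real.exp (2 * γ * s)) (Real.exp (2 * γ * s) * (2 * γ)) s := by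
      simpa using ((hasDerivAt_id s).const_mul (2 * γ)).exp
    refine (h1.hasDerivWithinAt.mul (h.hasDerivWithinAt_energy hs)).congr_deriv ?_
    rw [inner_weight]; ring
  have hsub : Icc 0 t ⊆ Ici 0 := fun s hs => hs.1
  have h1 := intervalIntegral.integral_eq_sub_of_hasDeriv_right_of_le ht
    (fun s hs => (hder s hs.1).continuousWithinAt.mono hsub)
    (fun s hs => (hder s hs.1.le).mono fun r hr => (hs.1.trans hr).le)
    ((h.continuousOn_work.mono hsub).intervalIntegrable_of_Icc ht)
  rw [integral_Icc_eq_integral_Ioc, ← intervalIntegral.integral_of_le ht, h1]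
  simp

/-- Against smooth fields, solutions with bounded initial energy are Lipschitz in time up to an error
that vanishes with `α`. -/
lemma exists_lipschitz (hγ : 0 < γ) (g : L2Vec) (R : ℝ) {w : V} (hw : w ∈ smoothFields) :
    ∃ L : ℝ, 0 ≤ L ∧ ∀ (α : ℝ) (u : ℝ → V), 0 < α → α ≤ 1 → IsSolution γ g α u →
      normSqH α (u 0) ≤ R → ∀ s t : ℝ, 0 ≤ s → 0 ≤ t →
        |inner ℝ (vel (u t)) (vel w) - inner ℝ (vel (u s)) (vel w)| ≤ L * |t - s| + L * √α := by
  obtain ⟨C, hC, hin⟩ := exists_inertial_le hw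
  set B := R + ‖g‖ ^ 2 / γ ^ 2 with hB
  -- The first three terms bound force, inertia and damping in the equation; the last one pays for
  -- the gradient products at the two end times. The absolute value keeps `L` nonnegative, since `R`
  -- has no sign.
  set L := ‖g‖ * ‖vel w‖ + C * |B| + γ * (√B * (‖vel w‖ + ‖grad w‖)) + 2 * (√B * ‖grad w‖) with hL
  have hL0 : 0 ≤ L := by positivity
  refine ⟨L, hL0, fun α u hα hα1 hu h0 => ?_⟩
  have hE : ∀ t, 0 ≤ t → normSqH α (u t) ≤ B := fun t ht =>
    (hu.energy_le hγ hα.le ht).trans (by linarith)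
  have hvel : ∀ t, 0 ≤ t → ‖vel (u t)‖ ≤ √B := fun t ht =>
    Real.le_sqrt_of_sq_le ((norm_vel_sq_le hα.le _).trans (hE t ht))
  -- The energy controls `√α ‖∇u‖`, which leaves a spare factor `√α`.
  have hgrad : ∀ t, 0 ≤ t → α * ‖grad (u t)‖ ≤ √α * √B := by
    intro t ht
    have h1 : (√α * ‖grad (u t)‖) ^ 2 ≤ B := by
      rw [mul_pow, Real.sq_sqrt hα.le]
      have := hE t ht
      unfold normSqH at this
      linarith [sq_nonneg ‖vel (u t)‖]
    have h2 := Real.le_sqrt_of_sq_le h1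
    calc α * ‖grad (u t)‖ = √α * (√α * ‖grad (u t)‖) := by
          rw [← mul_assoc, Real.mul_self_sqrt hα.le]
      _ ≤ √α * √B := mul_le_mul_of_nonneg_left h2 (Real.sqrt_nonneg _)
  have hgi : ∀ t, 0 ≤ t → |α * inner ℝ (grad (u t)) (grad w)| ≤ √α * (√B * ‖grad w‖) := by
    intro t ht
    rw [abs_mul, abs_of_pos hα]
    calc α * |inner ℝ (grad (u t)) (grad w)| ≤ α * (‖grad (u t)‖ * ‖grad w‖) :=
          mul_le_mul_of_nonneg_left (abs_real_inner_le_norm _ _) hα.le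
      _ = (α * ‖grad (u t)‖) * ‖grad w‖ := by ring
      _ ≤ (√α * √B) * ‖grad w‖ := mul_le_mul_of_nonneg_right (hgrad t ht) (norm_nonneg _)
      _ = _ := by ring
  have hα2 : √α ≤ 1 := Real.sqrt_le_one.2 hα1
  have hH : ∀ t, 0 ≤ t → |innerH α (u t) w| ≤ √B * (‖vel w‖ + ‖grad w‖) := by
    intro t ht
    have h1 : |inner ℝ (vel (u t)) (vel w)| ≤ √B * ‖vel w‖ :=
      (abs_real_inner_le_norm _ _).trans
        (mul_le_mul_of_nonneg_right (hvel t ht) (norm_nonneg _))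
    have h2 : √α * (√B * ‖grad w‖) ≤ √B * ‖grad w‖ :=
      mul_le_of_le_one_left (by positivity) hα2
    calc |innerH α (u t) w| ≤ _ := abs_add_le _ _
      _ ≤ √B * ‖vel w‖ + √B * ‖grad w‖ := add_le_add h1 ((hgi t ht).trans h2)
      _ = _ := by ring
  set D := ‖g‖ * ‖vel w‖ + C * |B| + γ * (√B * (‖vel w‖ + ‖grad w‖)) with hD
  have hder : ∀ t ∈ Ici (0 : ℝ), HasDerivWithinAt (fun t => innerH α (u t) w)
      (innerH α (derivWithin u (Ici 0) t) w) (Ici 0) t := by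
    intro t ht
    have h1 := ((hu.hasDerivWithinAt_vel ht).inner (𝕜 := ℝ)
      (hasDerivWithinAt_const t (Ici 0) (vel w))).add
      (((hu.hasDerivWithinAt_grad ht).inner (𝕜 := ℝ)
        (hasDerivWithinAt_const t (Ici 0) (grad w))).const_mul α)
    refine h1.congr_deriv ?_
    simp [innerH]
  have hbound : ∀ t ∈ Ici (0 : ℝ), ‖innerH α (derivWithin u (Ici 0) t) w‖ ≤ D := by
    intro t ht
    have h1 := hu.equation t ht w
    have h2 : innerH α (derivWithin u (Ici 0) t) w
        = inner ℝ g (vel w : L2Vec) - inertial (u t) (u t) w - γ * innerH α (u t) w := by linarith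
    rw [h2, Real.norm_eq_abs]
    have h3 : |inertial (u t) (u t) w| ≤ C * |B| :=
      (hin (u t)).trans (mul_le_mul_of_nonneg_left
        (((norm_vel_sq_le hα.le _).trans (hE t ht)).trans (le_abs_self _)) hC)
    have h4 : |γ * innerH α (u t) w| ≤ γ * (√B * (‖vel w‖ + ‖grad w‖)) := by
      rw [abs_mul, abs_of_pos hγ]
      exact mul_le_mul_of_nonneg_left (hH t ht) hγ.le
    have h5 : |inner ℝ g (vel w : L2Vec)| ≤ ‖g‖ * ‖vel w‖ := abs_real_inner_le_norm _ _
    have h6 := abs_sub (inner ℝ g (vel w : L2Vec) - inertial (u t) (u t) w) (γ * innerH α (u t) w)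
    have h7 := abs_sub (inner ℝ g (vel w : L2Vec)) (inertial (u t) (u t) w)
    linarith
  intro s t hs ht
  have h1 := (convex_Ici (0 : ℝ)).norm_image_sub_le_of_norm_hasDerivWithin_le hder hbound
    (mem_Ici.2 hs) (mem_Ici.2 ht)
  rw [Real.norm_eq_abs, Real.norm_eq_abs] at h1
  -- The equation bounds the time derivative of the `𝓗_α` product only; returning to the `L²`
  -- product costs two terms of order `√α`.
  have h2 : inner ℝ (vel (u t)) (vel w) - inner ℝ (vel (u s)) (vel w)
      = (innerH α (u t) w - innerH α (u s) w) + (α * inner ℝ (grad (u s)) (grad w)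
        - α * inner ℝ (grad (u t)) (grad w)) := by
    simp only [innerH]; ring
  rw [h2]
  have h3 := abs_add_le (innerH α (u t) w - innerH α (u s) w)
    (α * inner ℝ (grad (u s)) (grad w) - α * inner ℝ (grad (u t)) (grad w))
  have h4 := abs_sub (α * inner ℝ (grad (u s)) (grad w)) (α * inner ℝ (grad (u t)) (grad w))
  have h5 := hgi s hs
  have h6 := hgi t ht
  have h7 : D * |t - s| ≤ L * |t - s| := by
    refine mul_le_mul_of_nonneg_right ?_ (abs_nonneg _)
    have : 0 ≤ 2 * (√B * ‖grad w‖) := by positivity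
    linarith
  have h8 : 2 * (√α * (√B * ‖grad w‖)) ≤ L * √α := by
    have h9 : 2 * (√B * ‖grad w‖) ≤ L := by
      have : 0 ≤ D := by positivity
      linarith
    calc 2 * (√α * (√B * ‖grad w‖)) = (2 * (√B * ‖grad w‖)) * √α := by ring
      _ ≤ L * √α := mul_le_mul_of_nonneg_right h9 (Real.sqrt_nonneg _)
  linarith

end Energy

/-! ### Weak limits in Hilbert spaces -/

lemma cauchySeq_of_approx {q : ℕ → ℝ}
    (h : ∀ ε > 0, ∃ a : ℕ → ℝ, CauchySeq a ∧ ∀ n, |q n - a n| ≤ ε) : CauchySeq q := by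
  rw [Metric.cauchySeq_iff]
  intro ε hε
  obtain ⟨a, ha, hq⟩ := h (ε / 4) (by positivity)
  obtain ⟨N, hN⟩ := Metric.cauchySeq_iff.1 ha (ε / 4) (by positivity)
  refine ⟨N, fun m hm n hn => ?_⟩
  have h1 := hN m hm n hn
  rw [Real.dist_eq, abs_lt] at h1
  have h2 := abs_le.1 (hq m)
  have h3 := abs_le.1 (hq n)
  rw [Real.dist_eq, abs_lt]
  constructor <;> linarith [h1.1, h1.2, h2.1, h2.2, h3.1, h3.2]

section WeakLimits

variable {H : Type*} [NormedAddCommGroup H] [InnerProductSpace ℝ H]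

lemma norm_le_of_tendsto_inner {x : ℕ → H} {y : H} {ρ : ℝ} (hx : ∀ n, ‖x n‖ ≤ ρ)
    (h : Tendsto (fun n => inner ℝ (x n) y) atTop (𝓝 (inner ℝ y y))) : ‖y‖ ≤ ρ := by
  have h1 : inner ℝ y y ≤ ρ * ‖y‖ := le_of_tendsto' h fun n =>
    (real_inner_le_norm _ _).trans (mul_le_mul_of_nonneg_right (hx n) (norm_nonneg _))
  rw [real_inner_self_eq_norm_sq] at h1
  have hρ : 0 ≤ ρ := (norm_nonneg _).trans (hx 0)
  by_contra hcon
  push Not at hcon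
  nlinarith

/-- Boundedness extends the Cauchy property from `D` to all test vectors. The limit functional is
continuous by Banach–Steinhaus and is represented by a vector by Riesz. -/
lemma exists_tendsto_inner [CompleteSpace H] {D : Set H} (hD : Dense D) {x : ℕ → H} {ρ : ℝ}
    (hx : ∀ n, ‖x n‖ ≤ ρ) (h : ∀ w ∈ D, CauchySeq fun n => inner ℝ (x n) w) :
    ∃ y : H, ∀ w, Tendsto (fun n => inner ℝ (x n) w) atTop (𝓝 (inner ℝ y w)) := by
  have hρ : 0 ≤ ρ := (norm_nonneg _).trans (hx 0)
  have hall : ∀ w, CauchySeq fun n => inner ℝ (x n) w := by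
    intro w
    refine cauchySeq_of_approx fun ε hε => ?_
    obtain ⟨w', hw', hdist⟩ := Metric.dense_iff.1 hD w (ε / (ρ + 1)) (by positivity)
    refine ⟨_, h w' hdist, fun n => ?_⟩
    rw [← inner_sub_right]
    have h1 : ‖w - w'‖ ≤ ε / (ρ + 1) := by
      rw [← dist_eq_norm, dist_comm]; exact (Metric.mem_ball.1 hw').le
    calc |inner ℝ (x n) (w - w')| ≤ ‖x n‖ * ‖w - w'‖ := abs_real_inner_le_norm _ _
      _ ≤ ρ * (ε / (ρ + 1)) := mul_le_mul (hx n) h1 (norm_nonneg _) hρ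
      _ ≤ ε := by
        rw [mul_div_assoc', div_le_iff₀ (by positivity)]
        nlinarith
  choose f hf using fun w => cauchySeq_tendsto_of_complete (hall w)
  have htend : Tendsto (fun n w => innerSL ℝ (x n) w) atTop (𝓝 f) :=
    tendsto_pi_nhds.2 fun w => hf w
  refine ⟨(InnerProductSpace.toDual ℝ H).symm (continuousLinearMapOfTendsto _ htend),
    fun w => ?_⟩
  rw [InnerProductSpace.toDual_symm_apply]
  exact hf w

lemma tendsto_inner_of_dense [CompleteSpace H] {D : Set H} (hD : Dense D) {x : ℕ → H} {y : H}
    {ρ : ℝ} (hx : ∀ n, ‖x n‖ ≤ ρ)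
    (h : ∀ w ∈ D, Tendsto (fun n => inner ℝ (x n) w) atTop (𝓝 (inner ℝ y w))) (w : H) :
    Tendsto (fun n => inner ℝ (x n) w) atTop (𝓝 (inner ℝ y w)) := by
  obtain ⟨z, hz⟩ := exists_tendsto_inner hD hx fun w hw => (h w hw).cauchySeq
  have : z = y := hD.eq_of_inner_left ℝ fun w hw => tendsto_nhds_unique (hz w) (h w hw)
  exact this ▸ hz w

end WeakLimits

/-- Uniformly Lipschitz functions whose time averages converge, converge pointwise. -/
lemma cauchySeq_of_integral {q : ℕ → ℝ → ℝ} {L : ℝ} (hL : 0 ≤ L)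
    (hq : ∀ l s t, 0 ≤ s → 0 ≤ t → |q l t - q l s| ≤ L * |t - s|) {t : ℝ} (ht : 0 ≤ t)
    (hint : ∀ h > 0, CauchySeq fun l => ∫ s in Icc t (t + h), q l s) :
    CauchySeq fun l => q l t := by
  refine cauchySeq_of_approx fun ε hε => ?_
  -- The average over a window of length `h` differs from the value at `t` by at most `L * h ≤ ε`.
  set h := ε / (L + 1) with hh
  have hh0 : 0 < h := by positivity
  refine ⟨fun l => h⁻¹ * ∫ s in Icc t (t + h), q l s, ?_, fun l => ?_⟩
  · exact (uniformContinuous_const_smul (h⁻¹)).comp_cauchySeq (hint h hh0)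
  · have hcont : ContinuousOn (q l) (Ici 0) := by
      have : LipschitzOnWith ⟨L, hL⟩ (q l) (Ici 0) :=
        LipschitzOnWith.of_dist_le_mul fun s hs r hr => hq l r s hr hs
      exact this.continuousOn
    have hi : IntegrableOn (q l) (Icc t (t + h)) :=
      (hcont.mono fun s hs => ht.trans hs.1).integrableOn_Icc
    have hvol : (volume : Measure ℝ).real (Icc t (t + h)) = h := by
      rw [Real.volume_real_Icc_of_le (by linarith)]; ring
    have h1 : q l t - h⁻¹ * ∫ s in Icc t (t + h), q l s
        = h⁻¹ * ∫ s in Icc t (t + h), (q l t - q l s) := by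
      rw [integral_sub (integrable_const _) hi, setIntegral_const, hvol, smul_eq_mul]
      field_simp
    have h2 : ‖∫ s in Icc t (t + h), (q l t - q l s)‖ ≤ (L * h) * h := by
      have h3 := norm_setIntegral_le_of_norm_le_const (μ := (volume : Measure ℝ))
        (s := Icc t (t + h)) (f := fun s => q l t - q l s) (C := L * h) (by simp) ?_
      · rwa [hvol] at h3
      · intro s hs
        rw [Real.norm_eq_abs]
        refine (hq l s t (ht.trans hs.1) ht).trans (mul_le_mul_of_nonneg_left ?_ hL)
        rw [abs_le]; constructor <;> linarith [hs.1, hs.2]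
    rw [h1, abs_mul, abs_of_pos (inv_pos.2 hh0)]
    rw [Real.norm_eq_abs] at h2
    calc h⁻¹ * |∫ s in Icc t (t + h), (q l t - q l s)| ≤ h⁻¹ * ((L * h) * h) :=
          mul_le_mul_of_nonneg_left h2 (inv_pos.2 hh0).le
      _ = L * h := by field_simp
      _ ≤ ε := by
        rw [hh, mul_div_assoc', div_le_iff₀ (by positivity)]
        nlinarith

/-! ### Approximations -/

section Approximations

variable {γ : ℝ} {g : L2Vec}

/-- An approximation of `v` all of whose initial energies are at most `R`. -/
structure BddApproximates (γ : ℝ) (g : L2Vec) (R : ℝ) (v : ℝ → H0) (α : ℕ → ℝ)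
    (u : ℕ → ℝ → V) : Prop extends Approximates γ g v α u where
  le : ∀ n, normSqH (α n) (u n 0) ≤ R

/-- `L` is a Lipschitz constant against `w`, uniform over all solutions with initial energy at most
`R`, up to an error of order `√α`. -/
def IsLipschitzConst (γ : ℝ) (g : L2Vec) (R : ℝ) (w : H0) (L : ℝ) : Prop :=
  0 ≤ L ∧ ∀ (α : ℝ) (u : ℝ → V), 0 < α → α ≤ 1 → IsSolution γ g α u →
      normSqH α (u 0) ≤ R → ∀ s t : ℝ, 0 ≤ s → 0 ≤ t →
        |inner ℝ (vel (u t)) w - inner ℝ (vel (u s)) w| ≤ L * |t - s| + L * √α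

/-- The velocities of the smooth divergence free fields. -/
def smoothVelocities : Set H0 := smoothFields.map (velL : V →ₗ[ℝ] H0)

lemma dense_smoothVelocities : Dense smoothVelocities := by
  rw [dense_iff_closure_eq, smoothVelocities, ← Submodule.topologicalClosure_coe,
    smoothFields_map_closure]
  rfl

lemma exists_isLipschitzConst (hγ : 0 < γ) (g : L2Vec) (R : ℝ) {w : H0}
    (hw : w ∈ smoothVelocities) : ∃ L, IsLipschitzConst γ g R w L := by
  obtain ⟨v, hv, rfl⟩ := hw
  exact exists_lipschitz hγ g R hv

/-- A bound for the velocity of solutions with initial energy at most `R`. -/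
def velBound (γ : ℝ) (g : L2Vec) (R : ℝ) : ℝ := √(R + ‖g‖ ^ 2 / γ ^ 2)

lemma IsSolution.norm_vel_le {α R : ℝ} {u : ℝ → V} (h : IsSolution γ g α u) (hγ : 0 < γ)
    (hα : 0 < α) (hR : normSqH α (u 0) ≤ R) {t : ℝ} (ht : 0 ≤ t) :
    ‖vel (u t)‖ ≤ velBound γ g R := by
  refine Real.le_sqrt_of_sq_le ((norm_vel_sq_le hα.le _).trans ?_)
  linarith [h.energy_le hγ hα.le ht]

variable {v : ℝ → H0} {α : ℕ → ℝ} {u : ℕ → ℝ → V} {R : ℝ}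

lemma Approximates.comp (h : Approximates γ g v α u) {φ : ℕ → ℕ} (hφ : Tendsto φ atTop atTop) :
    Approximates γ g v (fun n => α (φ n)) (fun n => u (φ n)) where
  pos _ := h.pos _
  tendsto_zero := h.tendsto_zero.comp hφ
  solution _ := h.solution _
  bounded := h.bounded.imp fun _ hC _ => hC _
  weak t ht w := (h.weak t ht w).comp hφ

lemma BddApproximates.norm_le (h : BddApproximates γ g R v α u) (hγ : 0 < γ) {t : ℝ}
    (ht : 0 ≤ t) : ‖v t‖ ≤ velBound γ g R :=
  norm_le_of_tendsto_inner
    (fun n => (h.solution n).norm_vel_le hγ (h.pos n) (h.le n) ht) (h.weak t ht _)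

/-- The `√α` error disappears in the limit, so the limit trajectory is genuinely Lipschitz against
`w`. -/
lemma BddApproximates.lipschitz (h : BddApproximates γ g R v α u) {w : H0} {L : ℝ}
    (hL : IsLipschitzConst γ g R w L) {s t : ℝ} (hs : 0 ≤ s) (ht : 0 ≤ t) :
    |inner ℝ (v t) w - inner ℝ (v s) w| ≤ L * |t - s| := by
  have h1 : Tendsto (fun n => |inner ℝ (vel (u n t)) w - inner ℝ (vel (u n s)) w|) atTop
      (𝓝 |inner ℝ (v t) w - inner ℝ (v s) w|) := ((h.weak t ht w).sub (h.weak s hs w)).abs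
  have h2 : Tendsto (fun n => L * |t - s| + L * √(α n)) atTop (𝓝 (L * |t - s| + L * √0)) :=
    (h.tendsto_zero.sqrt.const_mul L).const_add _
  simp only [Real.sqrt_zero, mul_zero, add_zero] at h2
  refine le_of_tendsto_of_tendsto h1 h2 ?_
  filter_upwards [h.tendsto_zero.eventually_le_const one_pos] with n hn
  exact hL.2 _ _ (h.pos n) hn (h.solution n) (h.le n) s t hs ht

lemma BddApproximates.continuousOn_inner (h : BddApproximates γ g R v α u) {w : H0} {L : ℝ}
    (hL : IsLipschitzConst γ g R w L) : ContinuousOn (fun t => inner ℝ (v t) w) (Ici 0) := by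
  have : LipschitzOnWith ⟨L, hL.1⟩ (fun t => inner ℝ (v t) w) (Ici 0) :=
    LipschitzOnWith.of_dist_le_mul fun s hs r hr => h.lipschitz hL hr hs
  exact this.continuousOn

lemma exists_bddApproximates (hv : v ∈ K γ g) : ∃ R α u, BddApproximates γ g R v α u := by
  obtain ⟨α, u, h⟩ := hv
  obtain ⟨C, hC⟩ := h.bounded
  exact ⟨C, α, u, h, hC⟩

lemma exists_frequently_of_M_lt {t : ℝ} {b : ℝ} (h : M γ g v 0 t < ENNReal.ofReal b) :
    ∃ α u, Approximates γ g v α u ∧ ∃ᶠ n in atTop, normSqH (α n) (u n t) < b := by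
  simp only [M, iInf_lt_iff] at h
  obtain ⟨α, u, hu, hlt⟩ := h
  refine ⟨α, u, hu, (frequently_lt_of_liminf_lt (by isBoundedDefault) hlt).mono fun n hn => ?_⟩
  simpa using (ENNReal.ofReal_lt_ofReal_iff_of_nonneg (normSqH_nonneg (hu.pos n).le _)).1 hn

/-- A value of the lower limit below `R` bounds infinitely many initial energies, and a subsequence
of an approximation is again an approximation. -/
lemma exists_bddApproximates_of_M_lt (h : M γ g v 0 0 < ENNReal.ofReal R) :
    ∃ α u, BddApproximates γ g R v α u := by
  obtain ⟨α, u, hu, hfreq⟩ := exists_frequently_of_M_lt h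
  obtain ⟨φ, hφ, hlt⟩ := extraction_of_frequently_atTop hfreq
  exact ⟨_, _, hu.comp hφ.tendsto_atTop, fun n => (hlt n).le⟩

lemma Approximates.M_le (h : Approximates γ g v α u) {t b : ℝ}
    (hb : ∃ᶠ n in atTop, normSqH (α n) (u n t) ≤ b) : M γ g v 0 t ≤ ENNReal.ofReal b := by
  unfold M
  refine iInf_le_of_le α (iInf_le_of_le u (iInf_le_of_le h ?_))
  refine liminf_le_of_frequently_le' (hb.mono fun n hn => ?_)
  simpa using ENNReal.ofReal_le_ofReal hn

/-- The energy defect between times `0` and `t` is determined by the limit trajectory. -/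
lemma Approximates.tendsto_energy (h : Approximates γ g v α u) (hγ : 0 < γ) {t : ℝ}
    (ht : 0 ≤ t) :
    Tendsto (fun n => Real.exp (2 * γ * t) * normSqH (α n) (u n t) - normSqH (α n) (u n 0)) atTop
      (𝓝 (∫ s in Icc 0 t, inner ℝ (v s) (weight γ g s))) := by
  obtain ⟨R, hR⟩ := h.bounded
  simp only [fun n => (h.solution n).energy_eq ht]
  refine tendsto_integral_of_dominated_convergence
    (fun s => velBound γ g R * ‖weight γ g s‖) ?_ ?_ ?_ ?_
  · intro n
    exact (((h.solution n).continuousOn_work).mono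
      fun s hs => hs.1).aestronglyMeasurable measurableSet_Icc
  · exact ((continuous_weight γ g).norm.const_mul _).continuousOn.integrableOn_Icc
  · intro n
    refine (ae_restrict_iff' measurableSet_Icc).2 (ae_of_all _ fun s hs => ?_)
    exact (norm_inner_le_norm _ _).trans (mul_le_mul_of_nonneg_right
      ((h.solution n).norm_vel_le hγ (h.pos n) (hR n) hs.1) (norm_nonneg _))
  · exact (ae_restrict_iff' measurableSet_Icc).2 (ae_of_all _ fun s hs => h.weak s hs.1 _)

end Approximations

/-- Countability serves twice: the diagonal choice meets finitely many test fields at each stage,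
and countably many null sets have a null union. -/
lemma exists_dense_seq_smoothVelocities :
    ∃ σ : ℕ → smoothVelocities, Dense (range fun k => (σ k : H0)) := by
  -- The separability instance for `Lp` asks for this fact.
  have : Fact ((2 : ℝ≥0∞) ≠ ⊤) := ⟨by simp⟩
  have : Nonempty smoothVelocities := dense_smoothVelocities.nonempty.to_subtype
  exact ⟨TopologicalSpace.denseSeq smoothVelocities, dense_smoothVelocities.denseRange_val.comp
    (TopologicalSpace.denseRange_denseSeq _) continuous_subtype_val⟩

/-! ### Limits of trajectories -/

section Limit

variable {γ : ℝ} {g : L2Vec} {R : ℝ} {v : ℕ → ℝ → H0} {α : ℕ → ℕ → ℝ} {u : ℕ → ℕ → ℝ → V}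

/-- A diagonal sequence of approximations which is asymptotically weakly equal to `v`. -/
lemma exists_diagonal (hγ : 0 < γ) (h : ∀ l, BddApproximates γ g R (v l) (α l) (u l)) :
    ∃ n : ℕ → ℕ, Tendsto (fun l => α l (n l)) atTop (𝓝 0) ∧ ∀ t, 0 ≤ t → ∀ w : H0,
      Tendsto (fun l => inner ℝ (vel (u l (n l) t) - v l t) w) atTop (𝓝 0) := by
  obtain ⟨σ, hσd⟩ := exists_dense_seq_smoothVelocities
  set τ : ℕ → ℝ≥0 := TopologicalSpace.denseSeq ℝ≥0
  have hτ : DenseRange τ := TopologicalSpace.denseRange_denseSeq _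
  -- Stage `l` controls the first `l + 1` times and test fields with tolerance `1/(l+1)`; the
  -- Lipschitz bounds later fill in the remaining times.
  have hev : ∀ l : ℕ, ∃ n, α l n < 1 / ((l : ℝ) + 1) ∧
      ∀ j ∈ Finset.range (l + 1), ∀ k ∈ Finset.range (l + 1),
        |inner ℝ (vel (u l n (τ j)) - v l (τ j)) (σ k : H0)| < 1 / ((l : ℝ) + 1) := by
    intro l
    have hl : 0 < 1 / ((l : ℝ) + 1) := by positivity
    refine (((h l).tendsto_zero.eventually_lt_const hl).and ?_).exists
    rw [eventually_all_finset]
    intro j _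
    rw [eventually_all_finset]
    intro k _
    have h1 : Tendsto (fun n => |inner ℝ (vel (u l n (τ j)) - v l (τ j)) (σ k : H0)|) atTop
        (𝓝 0) := by
      simp only [inner_sub_left]
      have h2 := (((h l).weak (τ j) (τ j).2 (σ k)).sub_const
        (inner ℝ (v l (τ j)) (σ k : H0))).abs
      simpa using h2
    exact h1.eventually_lt_const hl
  choose n hn hd using hev
  have hzero : Tendsto (fun l : ℕ => 1 / ((l : ℝ) + 1)) atTop (𝓝 0) :=
    tendsto_one_div_add_atTop_nhds_zero_nat
  have hα : Tendsto (fun l => α l (n l)) atTop (𝓝 0) :=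
    squeeze_zero (fun l => ((h l).pos _).le) (fun l => (hn l).le) hzero
  refine ⟨n, hα, fun t ht w => ?_⟩
  have key := tendsto_inner_of_dense hσd (x := fun l => vel (u l (n l) t) - v l t) (y := 0)
    (ρ := velBound γ g R + velBound γ g R) ?_ ?_ w
  · simpa using key
  · intro l
    exact (norm_sub_le _ _).trans (add_le_add (((h l).solution _).norm_vel_le hγ ((h l).pos _)
      ((h l).le _) ht) ((h l).norm_le hγ ht))
  · rintro _ ⟨k, rfl⟩
    obtain ⟨L, hL⟩ := exists_isLipschitzConst hγ g R (σ k).2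
    rw [inner_zero_left, Metric.tendsto_atTop]
    intro ε hε
    -- Error budget: moving the solution and its limit trajectory from `t` to `τ j` costs `ε/4`
    -- each, and the diagonal tolerance plus the `√α` error costs less than `ε/4`.
    obtain ⟨j, hj⟩ := hτ.exists_dist_lt ⟨t, ht⟩ (ε := ε / (4 * (L + 1)))
      (div_pos hε (by linarith [hL.1]))
    have hdist : |t - τ j| < ε / (4 * (L + 1)) := hj
    have hLd : L * |t - τ j| ≤ ε / 4 := by
      have h1 : 0 < L + 1 := by linarith [hL.1]
      rw [lt_div_iff₀ (by positivity)] at hdist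
      nlinarith [abs_nonneg (t - τ j)]
    have hs : Tendsto (fun l : ℕ => 1 / ((l : ℝ) + 1) + L * √(α l (n l))) atTop
        (𝓝 (0 + L * √0)) := hzero.add (hα.sqrt.const_mul L)
    rw [Real.sqrt_zero, mul_zero, add_zero] at hs
    obtain ⟨N, hN⟩ := eventually_atTop.1 ((hs.eventually_lt_const
      (by positivity : 0 < ε / 4)).and (hα.eventually_le_const one_pos))
    refine ⟨max N (max j k), fun l hl => ?_⟩
    have hlN : N ≤ l := (le_max_left _ _).trans hl
    have hlj : j ≤ l := (le_max_left _ _).trans ((le_max_right _ _).trans hl)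
    have hlk : k ≤ l := (le_max_right _ _).trans ((le_max_right _ _).trans hl)
    obtain ⟨hs1, hs2⟩ := hN l hlN
    rw [Real.dist_eq, sub_zero]
    change |inner ℝ (vel (u l (n l) t) - v l t) (σ k : H0)| < ε
    have e1 := hd l j (Finset.mem_range.2 (by lia)) k (Finset.mem_range.2 (by lia))
    have e2 := hL.2 _ _ ((h l).pos (n l)) hs2 ((h l).solution _) ((h l).le _) (τ j) t (τ j).2 ht
    have e3 := (h l).lipschitz hL (τ j).2 ht
    rw [inner_sub_left] at e1 ⊢
    have triangle : ∀ a b c d : ℝ, |a - b| < 1 / ((l : ℝ) + 1) →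
        |c - a| ≤ L * |t - τ j| + L * √(α l (n l)) → |d - b| ≤ L * |t - τ j| →
        |c - d| < ε := by
      intro a b c d h1 h2 h3
      rw [abs_lt] at h1 ⊢
      rw [abs_le] at h2 h3
      constructor <;> linarith [h1.1, h1.2, h2.1, h2.2, h3.1, h3.2]
    exact triangle _ _ _ _ e1 e2 e3

lemma tendstoWeakStar_inner {u' : ℝ → H0} (hconv : TendstoWeakStar v u') {S : Set ℝ} {T : ℝ}
    (hS : MeasurableSet S) (hST : S ⊆ Icc 0 T) (w : H0) :
    Tendsto (fun l => ∫ s in S, inner ℝ (v l s) w) atTop (𝓝 (∫ s in S, inner ℝ (u' s) w)) := by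
  have hψ : Integrable (S.indicator fun _ => w) (volume.restrict (Icc 0 T)) :=
    (integrable_const w).indicator hS
  have hrw : ∀ f : ℝ → H0, ∫ s in Icc 0 T, inner ℝ (f s) (S.indicator (fun _ => w) s)
      = ∫ s in S, inner ℝ (f s) w := by
    intro f
    have : (fun s => inner ℝ (f s) (S.indicator (fun _ => w) s))
        = S.indicator fun s => inner ℝ (f s) w := by
      funext s
      by_cases hs : s ∈ S <;> simp [hs]
    rw [this, setIntegral_indicator hS, inter_eq_right.2 hST]
  simpa only [hrw] using hconv T _ hψ

/-- The pointwise weak limit of trajectories that converge weakly star. -/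
lemma exists_pointwise_limit (hγ : 0 < γ) (h : ∀ l, BddApproximates γ g R (v l) (α l) (u l))
    {u' : ℝ → H0} (hconv : TendstoWeakStar v u') :
    ∃ y : ℝ → H0, ∀ t, 0 ≤ t → ∀ w : H0,
      Tendsto (fun l => inner ℝ (v l t) w) atTop (𝓝 (inner ℝ (y t) w)) := by
  have hex : ∀ t, 0 ≤ t → ∃ y : H0, ∀ w : H0,
      Tendsto (fun l => inner ℝ (v l t) w) atTop (𝓝 (inner ℝ y w)) := by
    intro t ht
    refine exists_tendsto_inner dense_smoothVelocities (fun l => (h l).norm_le hγ ht)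
      fun w hw => ?_
    obtain ⟨L, hL⟩ := exists_isLipschitzConst hγ g R hw
    refine cauchySeq_of_integral (q := fun l s => inner ℝ (v l s) w) hL.1
      (fun l s r hs hr => (h l).lipschitz hL hs hr) ht fun δ _ => ?_
    exact (tendstoWeakStar_inner hconv measurableSet_Icc
      (Icc_subset_Icc_left ht) w).cauchySeq
  choose y hy using hex
  refine ⟨fun t => if ht : 0 ≤ t then y t ht else 0, fun t ht w => ?_⟩
  simpa only [ht, dite_true] using hy t ht w

/-- Integrals of `(v l, w)` over measurable sets in `[0,T]` converge to those of `(u', w)` by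
weak-star convergence and to those of `(y, w)` by dominated convergence. Letting `w` run through a
countable dense set gives one common null set. -/
lemma ae_eq_of_pointwise_limit (hγ : 0 < γ) (h : ∀ l, BddApproximates γ g R (v l) (α l) (u l))
    {u' : ℝ → H0} (hu' : MemLinftyLoc u') (hconv : TendstoWeakStar v u') {y : ℝ → H0}
    (hy : ∀ t, 0 ≤ t → ∀ w : H0,
      Tendsto (fun l => inner ℝ (v l t) w) atTop (𝓝 (inner ℝ (y t) w))) :
    u' =ᵐ[volume.restrict (Ici 0)] y := by
  obtain ⟨σ, hσd⟩ := exists_dense_seq_smoothVelocities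
  have hT : ∀ (T : ℕ) (k : ℕ), ∀ᵐ t ∂(volume.restrict (Icc (0 : ℝ) T)),
      inner ℝ (u' t) (σ k : H0) = inner ℝ (y t) (σ k : H0) := by
    intro T k
    obtain ⟨L, hL⟩ := exists_isLipschitzConst hγ g R (σ k).2
    have hmeas : ∀ l, AEStronglyMeasurable (fun t => inner ℝ (v l t) (σ k : H0))
        (volume.restrict (Icc (0 : ℝ) T)) := fun l =>
      (((h l).continuousOn_inner hL).mono fun s hs => hs.1).aestronglyMeasurable measurableSet_Icc
    have hbd : ∀ l, ∀ᵐ t ∂(volume.restrict (Icc (0 : ℝ) T)), ‖inner ℝ (v l t) (σ k : H0)‖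
        ≤ velBound γ g R * ‖(σ k : H0)‖ := fun l =>
      (ae_restrict_iff' measurableSet_Icc).2 (ae_of_all _ fun t ht =>
        (norm_inner_le_norm _ _).trans
          (mul_le_mul_of_nonneg_right ((h l).norm_le hγ ht.1) (norm_nonneg _)))
    have hlim : ∀ᵐ t ∂(volume.restrict (Icc (0 : ℝ) T)),
        Tendsto (fun l => inner ℝ (v l t) (σ k : H0)) atTop (𝓝 (inner ℝ (y t) (σ k : H0))) :=
      (ae_restrict_iff' measurableSet_Icc).2 (ae_of_all _ fun t ht => hy t ht.1 _)
    have hymeas := aestronglyMeasurable_of_tendsto_ae atTop hmeas hlim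
    have hyint : Integrable (fun t => inner ℝ (y t) (σ k : H0))
        (volume.restrict (Icc (0 : ℝ) T)) := by
      refine Integrable.of_bound hymeas (velBound γ g R * ‖(σ k : H0)‖) ?_
      filter_upwards [ae_all_iff.2 hbd, hlim] with t h1 h2
      exact le_of_tendsto' h2.norm h1
    have huint : Integrable (fun t => inner ℝ (u' t) (σ k : H0))
        (volume.restrict (Icc (0 : ℝ) T)) :=
      ((hu' T).integrable (by simp)).inner_const _
    refine huint.ae_eq_of_forall_setIntegral_eq _ _ hyint fun S hS _ => ?_
    rw [Measure.restrict_restrict hS]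
    have h1 := tendstoWeakStar_inner hconv (hS.inter measurableSet_Icc) inter_subset_right
      (σ k : H0) (T := (T : ℝ))
    refine tendsto_nhds_unique h1 ?_
    rw [← Measure.restrict_restrict hS]
    exact tendsto_integral_of_dominated_convergence (fun _ => velBound γ g R * ‖(σ k : H0)‖)
      (fun l => (hmeas l).restrict) (integrable_const _)
      (fun l => ae_restrict_of_ae (hbd l)) (ae_restrict_of_ae hlim)
  have hall : ∀ T : ℕ, ∀ᵐ t ∂(volume.restrict (Icc (0 : ℝ) T)), u' t = y t := by
    intro T
    filter_upwards [ae_all_iff.2 (hT T)] with t ht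
    refine hσd.eq_of_inner_left ℝ ?_
    rintro _ ⟨k, rfl⟩
    exact ht k
  have hU : Ici (0 : ℝ) = ⋃ T : ℕ, Icc (0 : ℝ) T := by
    ext t
    simp only [mem_Ici, mem_iUnion, mem_Icc]
    exact ⟨fun ht => (exists_nat_ge t).imp fun _ h => ⟨ht, h⟩, fun ⟨_, h⟩ => h.1⟩
  rw [hU]
  exact (ae_restrict_iUnion_iff _ _).2 hall

/-- Elements of `𝓚₀⁺` that agree almost everywhere agree everywhere on `[0,∞)`. -/
lemma eqOn_of_ae_eq (hγ : 0 < γ) {y z : ℝ → H0} (hy : y ∈ K γ g) (hz : z ∈ K γ g)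
    (h : y =ᵐ[volume.restrict (Ici 0)] z) : EqOn y z (Ici 0) := by
  obtain ⟨R₁, _, _, h₁⟩ := exists_bddApproximates hy
  obtain ⟨R₂, _, _, h₂⟩ := exists_bddApproximates hz
  intro t ht
  refine dense_smoothVelocities.eq_of_inner_left ℝ fun w hw => ?_
  obtain ⟨L₁, hL₁⟩ := exists_isLipschitzConst hγ g R₁ hw
  obtain ⟨L₂, hL₂⟩ := exists_isLipschitzConst hγ g R₂ hw
  refine Measure.eqOn_of_ae_eq (μ := (volume : Measure ℝ)) (s := Ici (0 : ℝ))
    (f := fun t => inner ℝ (y t) w) (g := fun t => inner ℝ (z t) w) ?_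
    (h₁.continuousOn_inner hL₁) (h₂.continuousOn_inner hL₂) ?_ ht
  · filter_upwards [h] with s hs
    rw [hs]
  · rw [interior_Ici, closure_Ioi]

/-- A bound on the energy at time `t` gives a bound on the initial energy. -/
lemma M_zero_le (hγ : 0 < γ) {y : ℝ → H0} {t b : ℝ} (ht : 0 ≤ t)
    (h : M γ g y 0 t < ENNReal.ofReal b) {δ : ℝ} (hδ : 0 < δ) :
    0 ≤ Real.exp (2 * γ * t) * b - (∫ s in Icc 0 t, inner ℝ (y s) (weight γ g s)) + δ ∧
    M γ g y 0 0 ≤ ENNReal.ofReal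
      (Real.exp (2 * γ * t) * b - (∫ s in Icc 0 t, inner ℝ (y s) (weight γ g s)) + δ) := by
  obtain ⟨α, u, hu, hfreq⟩ := exists_frequently_of_M_lt h
  have hev := (hu.tendsto_energy hγ ht).eventually_const_lt (sub_lt_self _ hδ)
  have hfreq2 : ∃ᶠ n in atTop, normSqH (α n) (u n 0) ≤
      Real.exp (2 * γ * t) * b - (∫ s in Icc 0 t, inner ℝ (y s) (weight γ g s)) + δ := by
    refine (hfreq.and_eventually hev).mono fun n hn => ?_
    have h1 := mul_le_mul_of_nonneg_left hn.1.le (Real.exp_pos (2 * γ * t)).le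
    linarith [hn.2]
  -- Nonnegativity is recorded because without it `ENNReal.ofReal` could truncate the bound.
  refine ⟨?_, hu.M_le hfreq2⟩
  obtain ⟨n, hn⟩ := hfreq2.exists
  exact (normSqH_nonneg (hu.pos n).le _).trans hn

/-- Weak star limits of trajectories with bounded initial `M`-functional are trajectories, and the
`M`-functional is lower semicontinuous along them. -/
theorem exists_limit_trajectory (hγ : 0 < γ) {u : ℕ → ℝ → H0} {C : ℝ≥0}
    (hC : ∀ l, M γ g (u l) 0 0 ≤ C) {u' : ℝ → H0} (hu' : MemLinftyLoc u')
    (hconv : TendstoWeakStar u u') :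
    ∃ v ∈ K γ g, u' =ᵐ[volume.restrict (Ici 0)] v ∧
      ∀ t : ℝ, 0 ≤ t → M γ g v 0 t ≤ liminf (fun l => M γ g (u l) 0 t) atTop := by
  -- The infimum need not be attained, so the `l`-th approximation is allowed the vanishing excess
  -- `1/(l+1)`.
  set r : ℕ → ℝ := fun l => (M γ g (u l) 0 0).toReal + 1 / ((l : ℝ) + 1) with hr
  have hfin : ∀ l, M γ g (u l) 0 0 ≠ ⊤ := fun l => ((hC l).trans_lt ENNReal.coe_lt_top).ne
  have hone : ∀ l : ℕ, 0 < 1 / ((l : ℝ) + 1) := fun l => by positivity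
  have hlt : ∀ l, M γ g (u l) 0 0 < ENNReal.ofReal (r l) := fun l =>
    (ENNReal.lt_ofReal_iff_toReal_lt (hfin l)).2 (lt_add_of_pos_right _ (hone l))
  choose α U hU using fun l => exists_bddApproximates_of_M_lt (hlt l)
  have hrC : ∀ l, r l ≤ C + 1 := by
    intro l
    have h1 : (M γ g (u l) 0 0).toReal ≤ C := ENNReal.toReal_le_coe_of_le_coe (hC l)
    have h2 : 1 / ((l : ℝ) + 1) ≤ 1 := by
      rw [div_le_one (by positivity)]; linarith [Nat.cast_nonneg (α := ℝ) l]
    exact add_le_add h1 h2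
  have hUC : ∀ l, BddApproximates γ g (C + 1) (u l) (α l) (U l) := fun l =>
    ⟨(hU l).toApproximates, fun n => ((hU l).le n).trans (hrC l)⟩
  obtain ⟨n, hα, hdiag⟩ := exists_diagonal hγ hUC
  obtain ⟨y, hy⟩ := exists_pointwise_limit hγ hUC hconv
  have happ : Approximates γ g y (fun l => α l (n l)) (fun l => U l (n l)) := by
    refine ⟨fun l => (hUC l).pos _, hα, fun l => (hUC l).solution _,
      ⟨C + 1, fun l => (hUC l).le _⟩, fun t ht w => ?_⟩
    have h1 := (hdiag t ht w).add (hy t ht w)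
    simpa only [inner_sub_left, sub_add_cancel, zero_add] using h1
  have hae := ae_eq_of_pointwise_limit hγ hUC hu' hconv hy
  refine ⟨y, ⟨_, _, happ⟩, hae, fun t ht => ?_⟩
  by_contra! hcon
  obtain ⟨b, hb0, hb1, hb2⟩ := ENNReal.lt_iff_exists_real_btwn.1 hcon
  obtain ⟨b', hb0', hb1', hb2'⟩ := ENNReal.lt_iff_exists_real_btwn.1 hb2
  refine hb2'.not_ge ?_
  have hbb : b < b' := (ENNReal.ofReal_lt_ofReal_iff_of_nonneg hb0).1 hb1'
  -- Four errors must fit between `b` and `b'`: the slack in `M_zero_le`, the excess in `r l`, the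
  -- convergence of `F (u l)`, and the energy limit along the diagonal. Since `exp (2γt) ≥ 1`, their
  -- sum is at most `exp (2γt) (b' - b)`.
  set δ := (b' - b) / 4 with hδ
  have hδ0 : 0 < δ := by rw [hδ]; linarith
  set F : (ℝ → H0) → ℝ := fun z => ∫ s in Icc 0 t, inner ℝ (z s) (weight γ g s)
  have hF : Tendsto (fun l => F (u l)) atTop (𝓝 (F y)) := by
    have h1 := hconv t (weight γ g) (continuous_weight γ g).continuousOn.integrableOn_Icc
    have h2 : F u' = F y := by
      refine integral_congr_ae ?_
      filter_upwards [ae_restrict_of_ae_restrict_of_subset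
        (fun s (hs : s ∈ Icc 0 t) => mem_Ici.2 hs.1) hae] with s hs
      rw [hs]
    rw [← h2]
    exact h1
  have hev := ((hF.eventually_const_lt (sub_lt_self _ hδ0)).and
    (tendsto_one_div_add_atTop_nhds_zero_nat.eventually_lt_const hδ0)).and
    ((happ.tendsto_energy hγ ht).eventually_lt_const (lt_add_of_pos_right _ hδ0))
  -- The indices realizing the lower limit depend on `t`, but the diagonal sequence does not; a
  -- bound along infinitely many indices suffices for `Approximates.M_le`.
  have hfreq := frequently_lt_of_liminf_lt (by isBoundedDefault) hb1
  refine happ.M_le ((hfreq.and_eventually hev).mono ?_)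
  rintro l ⟨hl, ⟨hl1, hl2⟩, hl3⟩
  obtain ⟨hX0, hX⟩ := M_zero_le hγ ht hl hδ0
  have h1 := ENNReal.toReal_le_of_le_ofReal hX0 hX
  have h2 := (hU l).le (n l)
  have he : 1 ≤ Real.exp (2 * γ * t) := Real.one_le_exp (by positivity)
  have h3 : Real.exp (2 * γ * t) * normSqH (α l (n l)) (U l (n l) t)
      ≤ Real.exp (2 * γ * t) * b + 4 * δ := by
    simp only [hr, F] at *
    linarith
  have h4 : Real.exp (2 * γ * t) * b + 4 * δ ≤ Real.exp (2 * γ * t) * b' := by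
    have : 4 * δ = b' - b := by rw [hδ]; ring
    nlinarith
  exact le_of_mul_le_mul_left (h3.trans h4) (Real.exp_pos _)

end Limit

end

end BardinaEuler

theorem proposition3 (γ : ℝ) (hγ : 0 < γ) (g : BardinaEuler.L2Vec)
    (u : ℕ → ℝ → BardinaEuler.H0) (hu : ∀ l, u l ∈ BardinaEuler.K γ g)
    (hM : ∃ C : ℝ≥0, ∀ l, BardinaEuler.M γ g (u l) 0 0 ≤ C)
    (u' : ℝ → BardinaEuler.H0) (hu' : BardinaEuler.MemLinftyLoc u')
    (hconv : BardinaEuler.TendstoWeakStar u u') :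
    ∃ v ∈ BardinaEuler.K γ g,
      u' =ᵐ[volume.restrict (Ici 0)] v ∧
      (∀ w ∈ BardinaEuler.K γ g, u' =ᵐ[volume.restrict (Ici 0)] w → EqOn w v (Ici 0)) ∧
      (∀ t : ℝ, 0 ≤ t →
        BardinaEuler.M γ g v 0 t ≤ liminf (fun l => BardinaEuler.M γ g (u l) 0 t) atTop) ∧
      (∀ C : ℝ≥0∞, (∀ l, BardinaEuler.M γ g (u l) 0 0 ≤ C) → BardinaEuler.M γ g v 0 0 ≤ C) := by
  obtain ⟨C, hC⟩ := hM
  obtain ⟨v, hv, hae, hlim⟩ := BardinaEuler.exists_limit_trajectory hγ hC hu' hconv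
  exact ⟨v, hv, hae, fun w hw hwu => BardinaEuler.eqOn_of_ae_eq hγ hw hv (hwu.symm.trans hae),
    -- Closedness of the sublevel sets is lower semicontinuity at `t = 0`.
    hlim, fun B hB => (hlim 0 le_rfl).trans
      (liminf_le_of_frequently_le' (Frequently.of_forall hB))⟩
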